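/- All graphs are finite and simple (no loops, no multiple edges). For a graph $X$ with $m$ edges, let $e_1,\dots,e_{2m}$ be its oriented edges (each edge of $X$ taken with both of its orientations), and write $s(e)$ and $t(e)$ for the starting and terminal vertex of an oriented edge $e$. Let $M=M(X)$ be the $2m\times 2m$ matrix with $M_{ij}=1$ if $t(e_i)=s(e_j)$ and $s(e_i)\neq t(e_j)$, and $M_{ij}=0$ otherwise. Then $M+M^T$ is a symmetric $0/1$ matrix with zero diagonal; the symmetric edge graph $\gamma(X)$ is the graph whose adjacency matrix is $M+M^T$. Theorem. Let $X$ and $Y$ be connected graphs. Then $\gamma(X)$ is isomorphic to $\gamma(Y)$ if and only if $X$ is isomorphic to $Y$. -/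

import Mathlib

namespace SimpleGraph

/-- The edge adjacency matrix `M` of a graph `X`, indexed by the oriented edges (darts) of `X`:
every edge of `X` occurs once with each of its two orientations, and `M e f = 1` exactly when
the terminal vertex of `e` is the starting vertex of `f` and the starting vertex of `e` is not
the terminal vertex of `f`. -/
def edgeAdjMatrix {V : Type*} [DecidableEq V] (X : SimpleGraph V) :
    Matrix X.Dart X.Dart ℕ :=
  Matrix.of fun e f => if e.snd = f.fst ∧ e.fst ≠ f.snd then 1 else 0

/-- The symmetric edge adjacency matrix `M + Mᵀ`. -/
def symmEdgeAdjMatrix {V : Type*} [DecidableEq V] (X : SimpleGraph V) :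
    Matrix X.Dart X.Dart ℕ :=
  X.edgeAdjMatrix + X.edgeAdjMatrix.transpose

theorem symmEdgeAdjMatrix_isAdjMatrix {V : Type*} [DecidableEq V] (X : SimpleGraph V) :
    X.symmEdgeAdjMatrix.IsAdjMatrix where
  zero_or_one e f := by
    simp only [symmEdgeAdjMatrix, edgeAdjMatrix, Matrix.add_apply, Matrix.transpose_apply,
      Matrix.of_apply]
    split_ifs <;> simp_all
  symm := by
    unfold Matrix.IsSymm
    rw [symmEdgeAdjMatrix, Matrix.transpose_add, Matrix.transpose_transpose, add_comm]
  apply_diag e := by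
    simp only [symmEdgeAdjMatrix, edgeAdjMatrix, Matrix.add_apply, Matrix.transpose_apply,
      Matrix.of_apply]
    split_ifs <;> simp_all

/-- The symmetric edge graph `γ(X)`: the graph whose adjacency matrix is `M + Mᵀ`. -/
def symmEdgeGraph {V : Type*} [DecidableEq V] (X : SimpleGraph V) : SimpleGraph X.Dart :=
  X.symmEdgeAdjMatrix_isAdjMatrix.toGraph

/-- The adjacency relation of `γ(X)`, read off from the matrix. -/
theorem symmEdgeGraph_adj {V : Type*} [DecidableEq V] (X : SimpleGraph V) (e f : X.Dart) :
    X.symmEdgeGraph.Adj e f ↔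
      (e.snd = f.fst ∧ e.fst ≠ f.snd) ∨ (f.snd = e.fst ∧ f.fst ≠ e.snd) := by
  change X.symmEdgeAdjMatrix e f = 1 ↔ _
  simp only [symmEdgeAdjMatrix, edgeAdjMatrix, Matrix.add_apply, Matrix.transpose_apply,
    Matrix.of_apply]
  split_ifs <;> simp_all

end SimpleGraph

/-! An isomorphism of the edge graphs transports the darts of `Y` to those of `X`. This leaves two
dart systems `S` and `T` on one set of darts with the same adjacency `A`, and the task is to compare
the reversals `S.r` and `p = T.r`. If they coincide, the graphs are isomorphic
(`graph_iso_of_r_eq`): two distinct neighbours `f`, `g` of `e` lie on the same side of `e` exactly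
when `f` is adjacent to the reversal of `g`. So `A` and the reversal determine the orientation up to
one global change, and vertices are classes of darts with a common source. It is also allowed to
relabel `T` by an automorphism of `A`.

What `A` knows about a reversal is collected in `IsDeck`. Below, distinct neighbours `f`, `g` of a
dart are on the same `p`-side if `A f (p g)`; there are at most two `p`-sides. The proof splits as
follows.

If `A` is disconnected, each reversal exchanges the two components, and twisting one component by `p
∘ S.r` makes the reversals equal (`graph_iso_of_split`).

If `A` is connected and the reversals agree at some dart, either the agreement spreads everywhere
(`Match`), or that dart is a rung. In the second case every dart is a rung or tame, `p` commutes
with `S.r`, and twisting part of the darts by `p ∘ S.r` restores agreement around the given dart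
(`graph_iso_of_common_reversal`).

If the reversals agree nowhere, the positions of `e`, `f`, `g` and their images under `p` can be
listed (`src_D`, `mix_BD`). Without hexagons rotated by `p`, `p` reverses all orientations and `S.r
∘ p` induces a free involution on vertices. Modulo this involution nonbacktracking walks are
deterministic, so a class of darts is never joined to its reversal; twisting outside one class
produces a common reversal (`graph_iso_of_no_hex`).

If there is a hexagon, the graph is one of four explicit graphs (`Hex.charted`). The other graph is
on the same list, and the degrees of darts in `A` tell the four apart (`graph_iso_of_hex`). -/

namespace SimpleGraph

/-! ### Dart systems and the traces of reversal in the adjacency -/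

/-- An abstract system of darts: `s` and `t` are the source and target maps, `r` the reversal. -/
structure DartSystem (D V : Type*) where
  s : D → V
  t : D → V
  r : D → D
  s_r : ∀ e, s (r e) = t e
  t_r : ∀ e, t (r e) = s e
  s_ne_t : ∀ e, s e ≠ t e
  ext : ∀ e f, s e = s f → t e = t f → e = f

namespace DartSystem

variable {D V : Type*} (S : DartSystem D V)

/-- `f` continues `e` without backtracking. -/
def To (e f : D) : Prop := S.t e = S.s f ∧ S.s e ≠ S.t f

/-- Adjacency of darts in the symmetric edge graph. -/
def A (e f : D) : Prop := S.To e f ∨ S.To f e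

/-- The dart system with all darts reversed. -/
def op : DartSystem D V where
  s := S.t
  t := S.s
  r := S.r
  s_r := S.t_r
  t_r := S.s_r
  s_ne_t e := (S.s_ne_t e).symm
  ext e f h h' := S.ext e f h' h

variable {S}

theorem A.symm {e f : D} (h : S.A e f) : S.A f e := Or.symm h

theorem op_To {e f : D} : S.op.To e f ↔ S.To f e := by
  simp only [To, op]; grind

theorem op_A : S.op.A = S.A := by
  funext e f; simp only [A, op_To]; grind

theorem r_r (e : D) : S.r (S.r e) = e :=
  S.ext _ _ (by rw [S.s_r, S.t_r]) (by rw [S.t_r, S.s_r])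

theorem r_ne (e : D) : S.r e ≠ e := fun h => S.s_ne_t e (by
  have := S.s_r e; rw [h] at this; exact this)

theorem r_inj {e f : D} : S.r e = S.r f ↔ e = f :=
  ⟨fun h => by rw [← r_r (S := S) e, h, r_r], fun h => by rw [h]⟩

theorem To_r {e f : D} : S.To (S.r e) (S.r f) ↔ S.To f e := by
  simp only [To, S.s_r, S.t_r]; grind

theorem A_r {e f : D} : S.A (S.r e) (S.r f) ↔ S.A e f := by
  simp only [A, To_r]; grind

theorem not_A_r (e : D) : ¬ S.A e (S.r e) := by
  have := S.s_ne_t e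
  simp only [A, To, S.s_r, S.t_r]; grind

theorem not_A_common_r {x e : D} (h : S.A x e) : ¬ S.A x (S.r e) := by
  have := S.s_ne_t e
  have := S.s_ne_t x
  simp only [A, To, S.s_r, S.t_r] at *; grind

theorem To.asymm {e f : D} (h : S.To e f) : ¬ S.To f e := by
  simp only [To] at *; grind

end DartSystem

open DartSystem

/-- The properties of the reversal of a dart system which can be expressed by the adjacency
relation of darts alone. -/
structure IsDeck {D : Type*} (A : D → D → Prop) (p : D → D) : Prop where
  pp : ∀ e, p (p e) = e
  pA : ∀ e f, A (p e) (p f) ↔ A e f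
  ne : ∀ e, p e ≠ e
  pn : ∀ e, ¬ A e (p e)
  pc : ∀ x e, A x e → ¬ A x (p e)
  trans : ∀ e f g h, A e f → A e g → A e h → f ≠ h → A f (p g) → A g (p h) → A f (p h)
  two : ∀ e f g h, A e f → A e g → A e h → f ≠ g → g ≠ h → f ≠ h →
    A f (p g) ∨ A g (p h) ∨ A f (p h)

namespace DartSystem

variable {D V : Type*} {S : DartSystem D V}

theorem A_r_of_To_To {e f g : D} (hf : S.To e f) (hg : S.To e g) (h : f ≠ g) :
    S.A f (S.r g) := by
  have := S.ext f g
  simp only [A, To, S.s_r, S.t_r] at *; grind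

theorem A_r_of_From_From {e f g : D} (hf : S.To f e) (hg : S.To g e) (h : f ≠ g) :
    S.A f (S.r g) := by
  have := S.ext f g
  simp only [A, To, S.s_r, S.t_r] at *; grind

theorem not_A_r_of_To_From {e f g : D} (hf : S.To e f) (hg : S.To g e) : ¬ S.A f (S.r g) := by
  have := S.s_ne_t e
  simp only [A, To, S.s_r, S.t_r] at *; grind

theorem not_A_r_of_From_To {e f g : D} (hf : S.To f e) (hg : S.To e g) : ¬ S.A f (S.r g) := by
  have := S.s_ne_t e
  simp only [A, To, S.s_r, S.t_r] at *; grind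

/-- Two neighbours of a dart lie on the same side of it. -/
theorem A_r_iff {e f g : D} (hf : S.A e f) (hg : S.A e g) (h : f ≠ g) :
    S.A f (S.r g) ↔ (S.To e f ↔ S.To e g) := by
  rcases hf with hf | hf <;> rcases hg with hg | hg
  · simp [A_r_of_To_To hf hg h, hf, hg]
  · simp [not_A_r_of_To_From hf hg, hf, hg.asymm]
  · simp [not_A_r_of_From_To hf hg, hg, hf.asymm]
  · simp [A_r_of_From_From hf hg h, hf.asymm, hg.asymm]

theorem isDeck (S : DartSystem D V) : IsDeck S.A S.r where
  pp := r_r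
  pA _ _ := A_r
  ne := r_ne
  pn := not_A_r
  pc _ _ := not_A_common_r
  trans e f g h hf hg hh hfh h₁ h₂ := by
    by_cases hfg : f = g
    · rwa [hfg]
    by_cases hgh : g = h
    · rwa [← hgh]
    rw [A_r_iff hf hg hfg] at h₁
    rw [A_r_iff hg hh hgh] at h₂
    rw [A_r_iff hf hh hfh]
    exact h₁.trans h₂
  two e f g h hf hg hh hfg hgh hfh := by
    rw [A_r_iff hf hg hfg, A_r_iff hg hh hgh, A_r_iff hf hh hfh]
    tauto

end DartSystem

theorem IsDeck.swap {D : Type*} {A : D → D → Prop} {p : D → D} (hp : IsDeck A p)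
    (hs : ∀ e f, A e f → A f e) {f g : D} (h : A f (p g)) : A g (p f) := by
  have := (hp.pA _ _).2 (hs _ _ h)
  rwa [hp.pp] at this

theorem IsDeck.A_p_left {D : Type*} {A : D → D → Prop} {p : D → D} (hp : IsDeck A p)
    {f g : D} : A (p f) g ↔ A f (p g) := by
  rw [← hp.pA, hp.pp]

/-! ### Relative positions of neighbouring darts under two reversals -/

namespace DartSystem

variable {D V : Type*} {S : DartSystem D V} {p : D → D}

/-- Each known adjacency among `e`, `f`, `g` and their images fixes a coincidence of endpoints in
one of two ways, and few combinations survive. In the fourth alternative `f, p g` and `g, p f` are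
two walks with common ends. In the last two a single dart is parallel to a walk of three, which
`no_square` excludes. -/
theorem src_cases (hp : IsDeck S.A p) {e f g : D} (hf : S.To e f) (hg : S.To e g)
    (hfg : f ≠ g) (h : S.A f (p g)) :
    p e = S.r e ∨ p f = S.r f ∨ p g = S.r g ∨
    (S.s (p f) = S.t g ∧ S.s (p g) = S.t f ∧ S.t (p f) = S.s (p e) ∧ S.t (p g) = S.s (p e)) ∨
    (S.s (p f) = S.t g ∧ S.s (p g) = S.t f ∧ S.t (p g) = S.s (p e) ∧ S.t (p e) = S.t g) ∨
    (S.s (p f) = S.t g ∧ S.s (p g) = S.t f ∧ S.t (p f) = S.s (p e) ∧ S.t (p e) = S.t f) := by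
  have h₁ := hp.swap (fun _ _ => A.symm) h
  have h₂ := hp.pn e
  have h₃ := hp.pn f
  have h₄ := hp.pn g
  have h₅ := (hp.pA e f).2 (.inl hf)
  have h₆ := (hp.pA e g).2 (.inl hg)
  have e₁ := S.ext (p e) (S.r e)
  have e₂ := S.ext (p f) (S.r f)
  have e₃ := S.ext (p g) (S.r g)
  have e₄ := S.ext f g
  have n₁ := S.s_ne_t (p e)
  simp only [A, To, S.s_r, S.t_r] at *
  grind

/-- The survivors, after the first, alternate. The second, fourth, sixth and eighth are squares with
one dart parallel to a walk of three. The third is a hexagon, and the fifth and seventh are pairs of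
two-step walks with common ends. -/
theorem mix_cases (hp : IsDeck S.A p) {e f h : D} (hf : S.To e f) (hh : S.To h e)
    (hfh : S.A f (p h)) :
    p e = S.r e ∨
    (S.t (p h) = S.t e ∧ S.s (p f) = S.s e ∧ S.s (p e) = S.t (p f) ∧ S.t (p e) = S.s (p h)) ∨
    (S.s (p h) = S.t f ∧ S.t (p f) = S.s h ∧ S.s (p e) = S.t (p h) ∧ S.t (p e) = S.s (p f)) ∨
    (S.s (p h) = S.t f ∧ S.t (p f) = S.s h ∧ S.s (p e) = S.s h ∧ S.t (p e) = S.t f) ∨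
    (S.t (p h) = S.t e ∧ S.t (p f) = S.s h ∧ S.s (p e) = S.s h ∧ S.t (p e) = S.s (p h)) ∨
    (S.t (p h) = S.t e ∧ S.t (p f) = S.s h ∧ S.s (p f) = S.s (p h) ∧ S.t (p e) = S.s (p h)) ∨
    (S.s (p h) = S.t f ∧ S.s (p f) = S.s e ∧ S.s (p e) = S.t (p f) ∧ S.t (p e) = S.t f) ∨
    (S.s (p h) = S.t f ∧ S.s (p f) = S.s e ∧ S.t (p f) = S.t (p h) ∧ S.s (p e) = S.t (p h)) := by
  have h₁ := hp.swap (fun _ _ => A.symm) hfh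
  have h₂ := hp.pn e
  have h₃ := hp.pn f
  have h₄ := hp.pn h
  have h₅ := (hp.pA e f).2 (.inl hf)
  have h₆ := (hp.pA e h).2 (.inr hh)
  have e₁ := S.ext (p e) (S.r e)
  have n₁ := S.s_ne_t (p e)
  simp only [A, To, S.s_r, S.t_r] at *
  grind (splits := 40)

end DartSystem

end SimpleGraph

/-! ### Equal reversals, spreading of agreement, and the disconnected case -/

namespace SimpleGraph
open DartSystem

/-- The relation `R` does not split the type into two unrelated parts. -/
def Unsplit {D : Type*} (R : D → D → Prop) : Prop :=
  ∀ P : D → Prop, (∀ e f, R e f → P e → P f) → ∀ e f, P e → P f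

namespace DartSystem

variable {D V W : Type*}

/-- The graph underlying a dart system. -/
def graph (S : DartSystem D V) : SimpleGraph V where
  Adj a b := ∃ e, S.s e = a ∧ S.t e = b
  symm := ⟨fun _ _ ⟨e, h, h'⟩ => ⟨S.r e, by rw [S.s_r, h'], by rw [S.t_r, h]⟩⟩
  loopless := ⟨fun _ ⟨e, h, h'⟩ => S.s_ne_t e (h.trans h'.symm)⟩

/-- The pullback of a dart system along a bijection. -/
def comap {D' : Type*} (T : DartSystem D V) (θ : D' ≃ D) : DartSystem D' V where
  s e := T.s (θ e)
  t e := T.t (θ e)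
  r e := θ.symm (T.r (θ e))
  s_r e := by simp [T.s_r]
  t_r e := by simp [T.t_r]
  s_ne_t e := T.s_ne_t _
  ext e f h h' := θ.injective (T.ext _ _ h h')

theorem comap_graph {D' : Type*} (T : DartSystem D V) (θ : D' ≃ D) :
    (T.comap θ).graph = T.graph := by
  ext a b
  exact ⟨fun ⟨e, h⟩ => ⟨θ e, h⟩, fun ⟨e, h⟩ => ⟨θ.symm e, by simpa [comap] using h⟩⟩

theorem comap_A {D' : Type*} (T : DartSystem D V) (θ : D' ≃ D) (e f : D') :
    (T.comap θ).A e f ↔ T.A (θ e) (θ f) := Iff.rfl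

theorem op_graph (T : DartSystem D V) : T.op.graph = T.graph := by
  ext a b
  exact ⟨fun ⟨e, h, h'⟩ => T.graph.adj_symm ⟨e, h', h⟩, fun h =>
    let ⟨e, h, h'⟩ := T.graph.adj_symm h; ⟨e, h', h⟩⟩

/-- Connectedness of a dart system. -/
def Conn (S : DartSystem D V) : Prop := Unsplit fun e f => S.A e f ∨ f = S.r e

theorem Conn.op {S : DartSystem D V} (h : S.Conn) : S.op.Conn := by
  unfold Conn
  rw [op_A]
  exact h

theorem s_eq_iff (S : DartSystem D V) {e f : D} :
    S.s e = S.s f ↔ e = f ∨ S.To (S.r e) f := by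
  have := S.ext e f
  simp only [To, S.s_r, S.t_r]; grind

/-- A vertex is a class of darts with equal source, and the target of a dart is the source of its
reversal; so this partition together with the reversal carries the whole graph. -/
theorem graph_iso_of_s_eq {S : DartSystem D V} {T : DartSystem D W} (hs : S.s.Surjective)
    (ht : T.s.Surjective) (hr : ∀ e, T.r e = S.r e)
    (h : ∀ e f, S.s e = S.s f ↔ T.s e = T.s f) : Nonempty (S.graph ≃g T.graph) := by
  choose i hi using hs
  choose j hj using ht
  have h₁ : ∀ e, T.s (i (S.s e)) = T.s e := fun e => (h _ _).1 (hi _)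
  have h₂ : ∀ e, S.s (j (T.s e)) = S.s e := fun e => (h _ _).2 (hj _)
  have h₃ : ∀ e, T.s (i (S.t e)) = T.t e := fun e => by
    rw [← S.s_r, h₁, ← hr, T.s_r]
  have h₄ : ∀ e, S.s (j (T.t e)) = S.t e := fun e => by
    rw [← T.s_r, h₂, hr, S.s_r]
  refine ⟨⟨⟨fun v => T.s (i v), fun w => S.s (j w), fun v => ?_, fun w => ?_⟩, ?_⟩⟩
  · simp only; rw [h₂, hi]
  · simp only; rw [h₁, hj]
  · intro a b
    constructor
    · rintro ⟨e, he, he'⟩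
      refine ⟨e, ?_, ?_⟩
      · rw [← h₂, he]; simp only [Equiv.coe_fn_mk]; rw [h₂, hi]
      · rw [← h₄, he']; simp only [Equiv.coe_fn_mk]; rw [h₂, hi]
    · rintro ⟨e, rfl, rfl⟩
      exact ⟨e, (h₁ e).symm, (h₃ e).symm⟩

theorem graph_iso_of_To_iff {S : DartSystem D V} {T : DartSystem D W} (hs : S.s.Surjective)
    (ht : T.s.Surjective) (hr : ∀ e, T.r e = S.r e)
    (h : ∀ e f, S.A e f → (S.To e f ↔ T.To e f)) (hA : ∀ e f, S.A e f ↔ T.A e f) :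
    Nonempty (S.graph ≃g T.graph) := by
  refine graph_iso_of_s_eq hs ht hr fun e f => ?_
  rw [s_eq_iff, s_eq_iff, hr]
  have : S.To (S.r e) f ↔ T.To (S.r e) f :=
    ⟨fun h' => (h _ _ (.inl h')).1 h', fun h' => (h _ _ ((hA _ _).2 (.inl h'))).2 h'⟩
  rw [this]

/-- The partition of the neighbours of `e` into sides depends only on `A` and the reversal, by
`A_r_iff`; the systems can differ at `e` only in which side is outgoing. -/
theorem sign_const {S : DartSystem D V} {T : DartSystem D W} (hr : ∀ e, T.r e = S.r e)
    (hA : ∀ e f, S.A e f ↔ T.A e f) {e f g : D} (hf : S.A e f) (hg : S.A e g) :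
    (S.To e f ↔ T.To e f) ↔ (S.To e g ↔ T.To e g) := by
  by_cases hfg : f = g
  · rw [hfg]
  have h₁ := S.A_r_iff hf hg hfg
  have h₂ := T.A_r_iff ((hA _ _).1 hf) ((hA _ _).1 hg) hfg
  rw [hr, ← hA, h₁] at h₂
  tauto

theorem A.not_To_iff {S : DartSystem D V} {e f : D} (h : S.A e f) : ¬ S.To e f ↔ S.To f e :=
  ⟨h.resolve_left, fun h => h.asymm⟩

theorem all_sign {S : DartSystem D V} {T : DartSystem D W} (hr : ∀ e, T.r e = S.r e)
    (hA : ∀ e f, S.A e f ↔ T.A e f) (hS : S.Conn) {e₀ : D}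
    (h₀ : ∀ f, S.A e₀ f → (S.To e₀ f ↔ T.To e₀ f)) (e : D) :
    ∀ f, S.A e f → (S.To e f ↔ T.To e f) := by
  refine hS (fun e => ∀ f, S.A e f → (S.To e f ↔ T.To e f)) ?_ e₀ e h₀
  rintro e f (hf | rfl) h g hg
  · have h₁ : S.To f e ↔ T.To f e := by
      rw [← hf.not_To_iff, ← ((hA _ _).1 hf).not_To_iff, h f hf]
    exact (sign_const hr hA hf.symm hg).1 h₁
  · have h₁ : S.A e (S.r g) := by
      rw [← A_r, r_r]; exact hg
    have h₂ := h _ h₁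
    rw [← To_r, r_r, ← T.To_r, hr, hr, r_r] at h₂
    rw [← hg.not_To_iff, ← ((hA _ _).1 hg).not_To_iff] at h₂
    tauto

/-- Systems with the same adjacency and the same reversal have isomorphic graphs. -/
theorem graph_iso_of_r_eq [Nonempty D] {S : DartSystem D V} {T : DartSystem D W}
    (hs : S.s.Surjective) (ht : T.s.Surjective) (hto : T.t.Surjective) (hS : S.Conn)
    (hA : ∀ e f, S.A e f ↔ T.A e f)
    (hr : ∀ e, T.r e = S.r e) : Nonempty (S.graph ≃g T.graph) := by
  obtain ⟨e₀⟩ := ‹Nonempty D›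
  by_cases h₀ : ∀ f, S.A e₀ f → (S.To e₀ f ↔ T.To e₀ f)
  · exact graph_iso_of_To_iff hs ht hr (all_sign hr hA hS h₀) hA
  -- Some orientation at `e₀` disagrees, hence all of them do, and `T.op` agrees with `S` there.
  · rw [← T.op_graph]
    push Not at h₀
    obtain ⟨f, hf, hf'⟩ := h₀
    have hA' : ∀ e f, S.A e f ↔ T.op.A e f := by rw [op_A]; exact hA
    refine graph_iso_of_To_iff hs hto hr (all_sign hr hA' hS (e₀ := e₀) fun g hg => ?_) hA'
    have h₁ := sign_const hr hA hf hg
    rw [op_To, ← ((hA _ _).1 hg).not_To_iff]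
    tauto

theorem t_surjective {T : DartSystem D V} (h : T.s.Surjective) : T.t.Surjective := fun v => by
  obtain ⟨e, rfl⟩ := h v
  exact ⟨T.r e, T.t_r e⟩

/-- The reversal `p` agrees with that of `S` at `e` and its neighbours. -/
def Match (S : DartSystem D V) (p : D → D) (e : D) : Prop :=
  p e = S.r e ∧ ∀ f, S.A e f → p f = S.r f

theorem Match.op {S : DartSystem D V} {p : D → D} {e : D} : S.op.Match p e ↔ S.Match p e := by
  unfold Match; rw [op_A]; rfl

theorem _root_.SimpleGraph.IsDeck.inj {D : Type*} {A : D → D → Prop} {p : D → D}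
    (hp : IsDeck A p) {e f : D} (h : p e = p f) : e = f := by
  rw [← hp.pp e, h, hp.pp]

theorem _root_.SimpleGraph.IsDeck.op {S : DartSystem D V} {p : D → D}
    (hp : IsDeck S.A p) : IsDeck S.op.A p := by rwa [op_A]

/-- Darts entering `f` are `e` or reversals of neighbours of `e`. For `k` leaving `f`, the dart `r
(p k)` is again a neighbour of `f`: if it leaves `f` it equals `k`, since otherwise `k` would be
adjacent to `p k`, and it cannot enter `f`. -/
theorem Match.of_To {S : DartSystem D V} {p : D → D} (hp : IsDeck S.A p) {e f : D}
    (he : S.Match p e) (hf : S.To e f) : S.Match p f := by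
  obtain ⟨he, hn⟩ := he
  have hpf := hn f (.inl hf)
  have hback : ∀ k, S.To k f → p k = S.r k := fun k hk => by
    by_cases hke : k = e
    · rw [hke, he]
    have h₁ : S.A e (S.r k) := by
      have := S.ext k e
      simp only [A, To, S.s_r, S.t_r] at *; grind
    have h₂ := hn _ h₁
    rw [r_r] at h₂
    rw [← h₂, hp.pp, h₂]
  refine ⟨hpf, fun k hk => ?_⟩
  rcases hk with hk | hk
  swap
  · exact hback k hk
  have h₁ : S.A f (S.r (p k)) := by
    rw [← A_r, r_r, ← hpf, hp.pA]; exact .inl hk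
  rcases h₁ with h₁ | h₁
  · by_contra hne
    have h₂ : k ≠ S.r (p k) := fun h => hne (by rw [h, r_r, ← h])
    have h₃ := A_r_of_To_To hk h₁ h₂
    rw [r_r] at h₃
    exact hp.pn _ h₃
  · have := hback _ h₁
    rw [r_r] at this
    rw [hp.inj this] at h₁
    exact absurd h₁ hk.asymm

theorem Match.of_A {S : DartSystem D V} {p : D → D} (hp : IsDeck S.A p) {e f : D}
    (he : S.Match p e) (hf : S.A e f) : S.Match p f := by
  rcases hf with hf | hf
  · exact he.of_To hp hf
  · exact Match.op.1 ((Match.op.2 he).of_To hp.op (op_To.2 hf))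

theorem isDeck_of_A {S : DartSystem D V} {T : DartSystem D W}
    (hA : ∀ e f, S.A e f ↔ T.A e f) : IsDeck S.A T.r := by
  have : S.A = T.A := by funext e f; exact propext (hA e f)
  rw [this]; exact T.isDeck

theorem Conn.of_unsplit {S : DartSystem D V} (h : Unsplit S.A) : S.Conn :=
  fun P hP => h P fun e f hef => hP e f (.inl hef)

theorem graph_iso_of_match {S : DartSystem D V} {T : DartSystem D W}
    (hs : S.s.Surjective) (ht : T.s.Surjective) (hA : ∀ e f, S.A e f ↔ T.A e f)
    (hC : Unsplit S.A) {e : D} (he : S.Match T.r e) : Nonempty (S.graph ≃g T.graph) := by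
  have : Nonempty D := ⟨e⟩
  refine graph_iso_of_r_eq hs ht (t_surjective ht) (.of_unsplit hC) hA fun f => ?_
  exact (hC (S.Match T.r) (fun e f hef h => h.of_A (isDeck_of_A hA) hef) e f he).1

/-- Applying an automorphism on one part of the darts only. -/
theorem exists_partial_perm {A : D → D → Prop} (hsymm : ∀ e f, A e f → A f e) (I : D → Prop)
    (Q : D ≃ D) (hQ : ∀ e f, A (Q e) (Q f) ↔ A e f) (hI : ∀ e, I (Q e) ↔ I e)
    (hc : ∀ i u, I i → ¬ I u → (A i u ↔ A i (Q u))) :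
    ∃ θ : D ≃ D, (∀ e f, A (θ e) (θ f) ↔ A e f) ∧ (∀ e, I e → θ e = e) ∧
      (∀ e, ¬ I e → θ e = Q e) := by
  classical
  have hI' : ∀ e, I (Q.symm e) ↔ I e := fun e => by rw [← hI, Q.apply_symm_apply]
  refine ⟨⟨fun e => if I e then e else Q e, fun e => if I e then e else Q.symm e,
    fun e => ?_, fun e => ?_⟩, fun e f => ?_, fun e he => ?_, fun e he => ?_⟩
  · by_cases h : I e <;> simp [h, hI]
  · by_cases h : I e <;> simp [h, hI']
  · have hs : ∀ e f, A e f ↔ A f e := fun e f => ⟨hsymm _ _, hsymm _ _⟩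
    by_cases he : I e <;> by_cases hf : I f <;> simp only [Equiv.coe_fn_mk, he, hf, if_true,
      if_false]
    · exact (hc _ _ he hf).symm
    · rw [hs, hs e]; exact (hc _ _ hf he).symm
    · exact hQ _ _
  · simp [he]
  · simp [he]

theorem graph_iso_of_equivariant [Nonempty D] {S : DartSystem D V} {T : DartSystem D W}
    (hs : S.s.Surjective) (ht : T.s.Surjective) (hS : S.Conn)
    (hA : ∀ e f, S.A e f ↔ T.A e f) (θ : D ≃ D) (hθ : ∀ e f, S.A (θ e) (θ f) ↔ S.A e f)
    (hr : ∀ e, T.r (θ e) = θ (S.r e)) : Nonempty (S.graph ≃g T.graph) := by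
  rw [← T.comap_graph θ]
  refine graph_iso_of_r_eq hs (ht.comp θ.surjective) ((t_surjective ht).comp θ.surjective) hS
    (fun e f => ?_) fun e => ?_
  · rw [comap_A, ← hA, hθ]
  · simp [comap, hr]

/-- Reversal as a permutation. -/
def rPerm (S : DartSystem D V) : D ≃ D := ⟨S.r, S.r, r_r, r_r⟩

/-- Since adjacency and reversal together connect all darts, each reversal exchanges the component
`I` of `e₀` with its complement. No adjacency crosses between the two, so the complement may be
twisted freely. -/
theorem graph_iso_of_split {S : DartSystem D V} {T : DartSystem D W}
    (hs : S.s.Surjective) (ht : T.s.Surjective) (hS : S.Conn) (hT : T.Conn)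
    (hA : ∀ e f, S.A e f ↔ T.A e f) (hC : ¬ Unsplit S.A) : Nonempty (S.graph ≃g T.graph) := by
  have hp := isDeck_of_A hA
  unfold Unsplit at hC
  push Not at hC
  obtain ⟨P, hP, e₀, f₀, he₀, hf₀⟩ := hC
  have : Nonempty D := ⟨e₀⟩
  set I := Relation.ReflTransGen S.A e₀ with hIdef
  have hIP : ∀ x, I x → P x := fun x hx => by
    induction hx with
    | refl => exact he₀
    | tail _ h ih => exact hP _ _ h ih
  have hIA : ∀ e f, S.A e f → I e → I f := fun e f h h' => h'.tail h
  have hsymm : ∀ x, I x → Relation.ReflTransGen S.A x e₀ := fun x hx => by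
    induction hx with
    | refl => exact .refl
    | tail _ h ih => exact ih.head h.symm
  have key : ∀ q : D → D, (∀ e, q (q e) = e) → (∀ e f, S.A (q e) (q f) ↔ S.A e f) →
      (∀ P : D → Prop, (∀ e f, (S.A e f ∨ f = q e) → P e → P f) → ∀ e f, P e → P f) →
      ∀ x, I (q x) ↔ ¬ I x := by
    intro q hq hqA hconn
    have h₁ : ∀ x, I x ∨ I (q x) := fun x => by
      refine hconn (fun x => I x ∨ I (q x)) ?_ e₀ x (.inl .refl)
      rintro e f (h | rfl) h'
      · exact h'.imp (hIA _ _ h) (hIA _ _ ((hqA _ _).2 h))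
      · rw [hq]; exact h'.symm
    have h₂ : ∀ x, I x → ¬ I (q x) := fun x hx hx' => by
      have h₃ : ∀ a b, Relation.ReflTransGen S.A a b → Relation.ReflTransGen S.A (q a) (q b) :=
        fun a b h => Relation.ReflTransGen.lift q (fun a b h => (hqA a b).2 h) _ _ h
      have h₄ : ∀ y, I y → I (q y) := fun y hy =>
        hx'.trans ((h₃ _ _ (hsymm x hx)).trans (h₃ _ _ hy))
      have h₅ : I f₀ := (h₁ f₀).elim id fun h => by have := h₄ _ h; rwa [hq] at this
      exact hf₀ (hIP _ h₅)
    exact fun x => ⟨fun h h' => h₂ _ h' h, fun h => (h₁ x).resolve_left h⟩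
  have hr := key S.r r_r (fun _ _ => A_r) hS
  have hp' := key T.r r_r hp.pA (by
    intro P hP; refine hT P fun e f h => hP e f ?_; rwa [hA])
  -- `θ` is the identity on `I` and `T.r ∘ S.r` elsewhere, which gives `T.r ∘ θ = θ ∘ S.r`.
  obtain ⟨θ, hθ, h₁, h₂⟩ := exists_partial_perm (A := S.A) (fun _ _ => A.symm) I
    (S.rPerm.trans T.rPerm) (fun e f => (hp.pA _ _).trans A_r)
    (fun e => by simp [rPerm, hp', hr])
    (fun i u hi hu => by
      constructor <;> intro h <;> exfalso
      · exact hu (hIA _ _ h hi)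
      · have := hIA _ _ h hi
        simp [rPerm, hp', hr] at this
        exact hu this)
  refine graph_iso_of_equivariant hs ht hS hA θ hθ fun e => ?_
  by_cases he : I e
  · rw [h₁ e he, h₂ (S.r e) (by simp [hr, he])]
    simp [rPerm, r_r]
  · rw [h₂ e he, h₁ (S.r e) (by simp [hr, he])]
    simp [rPerm, r_r]

end DartSystem
end SimpleGraph

/-! ### Rungs and tame darts -/

namespace SimpleGraph
open DartSystem

/-- With at most two sides, comparison with one reference neighbour `x` decides whether `g` and `h`
lie together. -/
theorem IsDeck.side_iff {D : Type*} {A : D → D → Prop} {p : D → D} (hp : IsDeck A p)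
    (hs : ∀ e f, A e f → A f e) {e x g h : D} (hx : A e x) (hg : A e g) (hh : A e h)
    (hxg : x ≠ g) (hxh : x ≠ h) (hgh : g ≠ h) :
    A g (p h) ↔ (A x (p g) ↔ A x (p h)) := by
  have h₁ := hp.trans e x g h hx hg hh hxh
  have h₂ := hp.trans e x h g hx hh hg hxg
  have h₃ := hp.trans e g x h hg hx hh hgh
  have h₄ := hp.two e x g h hx hg hh hxg hgh hxh
  have h₅ : A h (p g) ↔ A g (p h) := ⟨hp.swap hs, hp.swap hs⟩
  have h₆ : A x (p g) ↔ A g (p x) := ⟨hp.swap hs, hp.swap hs⟩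
  tauto

namespace DartSystem

variable {D V W : Type*} {S : DartSystem D V} {p : D → D}

theorem A.not_To_iff' {S : DartSystem D V} {e f : D} (h : S.A e f) : ¬ S.To f e ↔ S.To e f :=
  h.symm.not_To_iff

/-- `p` preserves the orientation of adjacencies at `e`. -/
def Keeps (S : DartSystem D V) (p : D → D) (e : D) : Prop :=
  ∀ f, S.A e f → (S.To e f ↔ S.To (p e) (p f))

/-- `p` reverses `e` and exchanges its incoming and outgoing neighbours. -/
def Rung (S : DartSystem D V) (p : D → D) (e : D) : Prop :=
  p e = S.r e ∧ S.Keeps p e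

/-- `p` preserves orientation at `e` and determines the same sides of `e` as the reversal. -/
def Tame (S : DartSystem D V) (p : D → D) (e : D) : Prop :=
  S.Keeps p e ∧ ∀ g h, S.A e g → S.A e h → g ≠ h → (S.A g (p h) ↔ S.A g (S.r h))

theorem keeps_op (hp : IsDeck S.A p) {e : D} : S.op.Keeps p e ↔ S.Keeps p e := by
  unfold Keeps
  rw [op_A]
  refine forall_congr' fun f => forall_congr' fun hf => ?_
  rw [op_To, op_To, ← hf.not_To_iff, ← ((hp.pA _ _).2 hf).not_To_iff]
  tauto

theorem rung_op (hp : IsDeck S.A p) {e : D} : S.op.Rung p e ↔ S.Rung p e := by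
  unfold Rung; rw [keeps_op hp]; rfl

theorem tame_op (hp : IsDeck S.A p) {e : D} : S.op.Tame p e ↔ S.Tame p e := by
  unfold Tame; rw [keeps_op hp, op_A]; rfl

theorem r_eq_iff {e f : D} : S.r e = f ↔ e = S.r f := by
  rw [← r_inj (S := S), r_r]

section fixed

variable (hp : IsDeck S.A p) {e : D} (he : p e = S.r e)
include hp he

theorem A_rp {f : D} (hf : S.A e f) : S.A e (S.r (p f)) := by
  rw [← A_r, r_r, ← he, hp.pA]; exact hf

/-- The map `r ∘ p` sends neighbours of `e` to neighbours of `e`. Were `f` and a different `r (p f)`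
on the same side, `f` would be adjacent to `p f`. -/
theorem rp_From {f : D} (hf : S.To e f) (hne : p f ≠ S.r f) : S.To (S.r (p f)) e := by
  refine (A_rp hp he (.inl hf)).resolve_left fun h => ?_
  have h₁ := A_r_of_To_To hf h (fun h => hne (r_eq_iff.1 h.symm))
  rw [r_r] at h₁
  exact hp.pn _ h₁

/-- A neighbour `k` fixed by `r ∘ p` would be on the same side as `f` exactly when it is on the same
side as `r (p f)`; but these two are on opposite sides. -/
theorem not_fixed_of_To {f k : D} (hf : S.To e f) (hne : p f ≠ S.r f) (hk : S.A e k) :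
    p k ≠ S.r k := by
  intro h
  have hqf := rp_From hp he hf hne
  have h₀ : S.A (S.r (p f)) (S.r k) ↔ S.A f (S.r k) := by
    rw [A_r, hp.A_p_left, h]
  rcases hk with hk | hk
  · exact not_A_r_of_From_To hqf hk (h₀.2 (A_r_of_To_To hf hk (by rintro rfl; exact hne h)))
  · refine not_A_r_of_To_From hf hk (h₀.1 (A_r_of_From_From hqf hk ?_))
    rintro rfl
    rw [r_r] at h
    exact hne (r_eq_iff.1 (hp.inj h))

end fixed

theorem not_fixed (hp : IsDeck S.A p) {e : D} (he : p e = S.r e) {f k : D} (hf : S.A e f)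
    (hne : p f ≠ S.r f) (hk : S.A e k) : p k ≠ S.r k := by
  rcases hf with hf | hf
  · exact not_fixed_of_To hp he hf hne hk
  · exact not_fixed_of_To (S := S.op) hp.op he (op_To.2 hf) hne (by rwa [op_A])

theorem rung_of_unfixed (hp : IsDeck S.A p) {e : D} (he : p e = S.r e) {f : D} (hf : S.A e f)
    (hne : p f ≠ S.r f) : S.Rung p e := by
  refine ⟨he, fun k hk => ?_⟩
  have h := not_fixed hp he hf hne hk
  rw [he]
  rcases hk with hk | hk
  · refine iff_of_true hk ?_
    rw [← To_r, r_r]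
    exact rp_From hp he hk h
  · refine iff_of_false hk.asymm ?_
    have := op_To.1 (rp_From (S := S.op) hp.op he (op_To.2 hk) h)
    change S.To e (S.r (p k)) at this
    rw [← To_r, r_r] at this
    exact this.asymm

section rung

variable {e : D}

theorem Rung.To_iff (he : S.Rung p e) {f : D} (hf : S.A e f) :
    S.To (S.r (p f)) e ↔ S.To e f := by
  rw [he.2 f hf, he.1, ← To_r, r_r]

variable (hp : IsDeck S.A p) (he : S.Rung p e)
include hp he

/-- At a rung `r ∘ p` exchanges the two sides, so its square keeps them. If the square moved `f`,
being on the same side would make `p f` adjacent to `r (p f)`. -/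
theorem Rung.comm {f : D} (hf : S.A e f) : p (S.r f) = S.r (p f) := by
  have h₁ := A_rp hp he.1 hf
  have h₂ := A_rp hp he.1 h₁
  have h₃ : S.To e f ↔ S.To e (S.r (p (S.r (p f)))) := by
    have h₄ := he.To_iff hf
    have h₅ := he.To_iff h₁
    have h₆ := h₁.not_To_iff
    have h₇ := h₂.not_To_iff
    tauto
  by_contra hne
  have h₄ : f ≠ S.r (p (S.r (p f))) := fun h => hne (by
    rw [eq_comm, r_eq_iff] at h
    rw [← h, hp.pp])
  have := (A_r_iff hf h₂ h₄).2 h₃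
  rw [r_r, ← hp.A_p_left] at this
  exact not_A_r _ this

theorem Rung.r : S.Rung p (S.r e) := by
  have hpr : p (S.r e) = e := by rw [← he.1, hp.pp]
  refine ⟨by rw [hpr, r_r], fun f hf => ?_⟩
  have hf' : S.A e (S.r f) := by rwa [← A_r, r_r]
  have h₁ := he.To_iff hf'
  have h₂ := he.comm hp hf'
  rw [r_r] at h₂
  rw [← h₂] at h₁
  have h₃ : S.A e (p f) := by
    rw [← hpr, hp.pA]; exact hf
  rw [hpr, ← h₃.not_To_iff', h₁, hf'.not_To_iff, ← To_r, r_r]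

/-- Other darts entering `f` are reversals of neighbours of the rung `e`, where `p` commutes with
`r`; darts leaving `f` are on the other side from `e` for both reversals. So `e` serves as the
reference neighbour in `side_iff`. -/
theorem Rung.tame_of_To {f : D} (hf : S.To e f) : S.Tame p f := by
  have hpf := (he.To_iff (.inl hf)).2 hf
  have key : ∀ g, S.A f g → g ≠ e → (S.A e (p g) ↔ S.A e (S.r g)) ∧
      (S.To f g ↔ S.To (p f) (p g)) := by
    intro g hg hge
    rcases hg with hg | hg
    · have h₁ : ¬ S.A e (S.r g) := by
        simp only [A, To, S.s_r, S.t_r] at *; grind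
      have h₂ : ¬ S.A e (p g) := fun h => h₁ (by
        have := A_rp hp he.1 h
        rwa [hp.pp] at this)
      refine ⟨iff_of_false h₂ h₁, iff_of_true hg ?_⟩
      refine ((hp.pA _ _).2 (.inl hg)).resolve_right fun h => h₂ (.inr ?_)
      have h₃ : p g ≠ S.r e := fun h => hge (hp.inj (h.trans he.1.symm))
      have h₄ := S.ext (p g) (S.r e)
      simp only [To, S.s_r, S.t_r] at *; grind
    · have h₁ : S.To e (S.r g) := by
        have := S.ext g e
        simp only [To, S.s_r, S.t_r] at *; grind
      have h₂ := he.comm hp (.inl h₁)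
      rw [r_r] at h₂
      have h₃ := A_rp hp he.1 (.inl h₁)
      have h₄ := (he.To_iff (.inl h₁)).2 h₁
      rw [← h₂] at h₃ h₄
      refine ⟨iff_of_true h₃ (.inl h₁), iff_of_false hg.asymm (To.asymm ?_)⟩
      have h₅ : p g ≠ S.r (p f) := fun h => by
        rw [← he.comm hp (.inl hf)] at h
        have := hp.inj h
        rw [this] at hg
        exact not_A_r _ (.inr hg)
      have h₆ := S.ext (p g) (S.r (p f))
      simp only [To, S.s_r, S.t_r] at *; grind
  refine ⟨fun g hg => ?_, fun g h hg hh hgh => ?_⟩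
  · by_cases hge : g = e
    · rw [hge]
      exact iff_of_false hf.asymm (To.asymm ((he.2 f (.inl hf)).1 hf))
    · exact (key g hg hge).2
  · have hfe : S.A f e := .inr hf
    have hs : ∀ e f, S.A e f → S.A f e := fun _ _ => A.symm
    by_cases hge : e = g
    · rw [← hge]
      exact (key h hh fun h' => hgh (hge.symm.trans h'.symm)).1
    by_cases hhe : e = h
    · rw [← hhe]
      have := (key g hg (Ne.symm hge)).1
      exact ⟨fun h => S.isDeck.swap hs (this.1 (hp.swap hs h)),
        fun h => hp.swap hs (this.2 (S.isDeck.swap hs h))⟩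
    rw [hp.side_iff hs hfe hg hh hge hhe hgh, S.isDeck.side_iff hs hfe hg hh hge hhe hgh,
      (key g hg (Ne.symm hge)).1, (key h hh (Ne.symm hhe)).1]

omit he in
theorem Rung.tame (he : S.Rung p e) {f : D} (hf : S.A e f) : S.Tame p f := by
  rcases hf with hf | hf
  · exact he.tame_of_To hp hf
  · exact (tame_op hp).1 (((rung_op hp).2 he).tame_of_To (S := S.op) hp.op (op_To.2 hf))

end rung

/-- Of two darts entering a tame dart exactly one is reversed by `p`. -/
theorem Tame.exactly_one (hp : IsDeck S.A p) {f k k' : D} (hf : S.Tame p f) (hk : S.To k f)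
    (hk' : S.To k' f) (hne : k ≠ k') : (p k = S.r k ∧ p k' ≠ S.r k') ∨
      (p k' = S.r k' ∧ p k ≠ S.r k) := by
  have h₁ := (hf.2 k k' (.inr hk) (.inr hk') hne).2 (A_r_of_From_From hk hk' hne)
  have h₂ := hp.swap (fun _ _ => A.symm) h₁
  have keep : ∀ k, S.To k f → S.To (p k) (p f) := fun k hk => by
    have hA : S.A f k := .inr hk
    rw [← ((hp.pA _ _).2 hA).not_To_iff, ← hf.1 k hA]
    exact hk.asymm
  have h₃ := keep k hk
  have h₄ := keep k' hk'
  have h₅ : p k ≠ p k' := fun h => hne (hp.inj h)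
  have e₁ := S.ext (p k) (S.r k)
  have e₂ := S.ext (p k') (S.r k')
  have e₃ := S.ext k k'
  have e₄ := S.ext (p k) (p k')
  have n₁ := S.s_ne_t k
  have n₂ := S.s_ne_t k'
  have n₃ := S.s_ne_t (p k)
  have n₄ := S.s_ne_t (p k')
  have r₁ := S.s_r k
  have r₂ := S.t_r k
  have r₃ := S.s_r k'
  have r₄ := S.t_r k'
  simp only [A, To] at *
  grind (splits := 30)

theorem Tame.keeps_From (hp : IsDeck S.A p) {f k : D} (hf : S.Tame p f) (hk : S.To k f) :
    S.To (p k) (p f) := by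
  have hA : S.A f k := .inr hk
  rw [← ((hp.pA _ _).2 hA).not_To_iff, ← hf.1 k hA]
  exact hk.asymm

theorem Tame.rung_of_From (hp : IsDeck S.A p) {f k : D} (hf : S.Tame p f) (hk : S.To k f)
    (h : p k = S.r k) : S.Rung p k := by
  refine rung_of_unfixed hp h (.inl hk) fun h' => ?_
  have := hf.keeps_From hp hk
  rw [h, h', To_r] at this
  exact hk.asymm this

theorem Tame.tame_of_unique (hp : IsDeck S.A p) {f k : D} (hf : S.Tame p f) (hk : S.To k f)
    (hu : ∀ k', S.To k' f → k' = k) : S.Tame p k := by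
  have hpk := hf.keeps_From hp hk
  have h₁ : ∀ g, S.To (p k) g → g = p f := fun g hg => by
    by_contra hne
    have h₂ : S.To (S.r g) (p f) := by
      have := S.ext g (p f)
      simp only [To, S.s_r, S.t_r] at *; grind
    have h₃ : S.A f (p (S.r g)) := by
      rw [← hp.A_p_left]; exact .inr h₂
    have h₄ : S.To (p (S.r g)) f := by
      rw [← h₃.not_To_iff, hf.1 _ h₃, hp.pp]
      exact h₂.asymm
    have h₅ := hu _ h₄
    rw [← h₅, hp.pp] at hg
    exact not_A_r g (.inr hg)
  have h₂ : ∀ g, S.To k g → g = f := fun g hg => by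
    by_contra hne
    have h₂ : S.To (S.r g) f := by
      have := S.ext g f
      simp only [To, S.s_r, S.t_r] at *; grind
    rw [← hu _ h₂] at hg
    exact not_A_r g (.inr hg)
  have hkf : S.A k f := .inl hk
  have key : ∀ g, S.A k g → f ≠ g → (S.A f (p g) ↔ S.A f (S.r g)) := fun g hg hne => by
    have h₃ : S.To g k := hg.not_To_iff.1 fun h => hne (h₂ g h).symm
    refine iff_of_false (fun h => ?_) (not_A_r_of_To_From hk h₃)
    rcases h with h | h
    · by_cases h₄ : k = p g
      · rw [h₄] at h₃
        exact hp.pn _ (.inl h₃)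
      · have := (hf.2 k (p g) (.inr hk) (.inl h) h₄).1 (by rw [hp.pp]; exact .inr h₃)
        exact not_A_r_of_From_To hk h this
    · have := hu _ h
      rw [← this] at h₃
      exact hp.pn _ (.inl h₃)
  refine ⟨fun g hg => ?_, fun g h hg hh hgh => ?_⟩
  · rcases hg with hg | hg
    · rw [h₂ g hg]; exact iff_of_true hk hpk
    · refine iff_of_false hg.asymm fun h => ?_
      rw [hp.inj (h₁ _ h)] at hg
      exact hg.asymm hk
  · have hs : ∀ e f, S.A e f → S.A f e := fun _ _ => A.symm
    by_cases hge : f = g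
    · rw [← hge]
      exact key h hh fun h' => hgh (hge.symm.trans h')
    by_cases hhe : f = h
    · rw [← hhe]
      have := key g hg hge
      exact ⟨fun h => S.isDeck.swap hs (this.1 (hp.swap hs h)),
        fun h => hp.swap hs (this.2 (S.isDeck.swap hs h))⟩
    rw [hp.side_iff hs hkf hg hh hge hhe hgh, S.isDeck.side_iff hs hkf hg hh hge hhe hgh,
      key g hg hge, key h hh hhe]

/-- If `k` is not reversed alike but another dart `k'` enters `f`, then `k'` is a rung by
`exactly_one`, and `k` is tame as a neighbour of the rung `r k'`. -/
theorem Tame.of_From (hp : IsDeck S.A p) {f k : D} (hf : S.Tame p f) (hk : S.To k f) :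
    S.Rung p k ∨ S.Tame p k := by
  by_cases h : p k = S.r k
  · exact .inl (hf.rung_of_From hp hk h)
  refine .inr ?_
  by_cases hu : ∀ k', S.To k' f → k' = k
  · exact hf.tame_of_unique hp hk hu
  push Not at hu
  obtain ⟨k', hk', hne⟩ := hu
  have h₁ : p k' = S.r k' := by
    rcases hf.exactly_one hp hk hk' hne.symm with h' | h'
    · exact absurd h'.1 h
    · exact h'.1
  refine ((hf.rung_of_From hp hk' h₁).r hp).tame hp (.inr ?_)
  have := S.ext k k'
  simp only [To, S.s_r, S.t_r] at *; grind

theorem rung_or_tame (hp : IsDeck S.A p) (hC : Unsplit S.A) {e : D} (he : S.Rung p e) (f : D) :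
    S.Rung p f ∨ S.Tame p f := by
  refine hC (fun f => S.Rung p f ∨ S.Tame p f) ?_ e f (.inl he)
  rintro f g hg (hf | hf)
  · exact .inr (hf.tame hp hg)
  · rcases hg with hg | hg
    · have := ((tame_op hp).2 hf).of_From (S := S.op) hp.op (op_To.2 hg)
      rwa [rung_op hp, tame_op hp] at this
    · exact hf.of_From hp hg

/-- Both `p f` and `r (p (r f))` follow `p e`; if they differed, `f` would be adjacent to `r f`. -/
theorem comm_of_To (hp : IsDeck S.A p) (hk : ∀ e, S.Keeps p e) {e f : D} (hf : S.To e f)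
    (he : p (S.r e) = S.r (p e)) : p (S.r f) = S.r (p f) := by
  have h₁ := (hk e f (.inl hf)).1 hf
  have h₂ := (hk _ _ (.inl (To_r.2 hf))).1 (To_r.2 hf)
  rw [he, ← To_r, r_r] at h₂
  by_contra hne
  have := A_r_of_To_To h₁ h₂ (fun h => hne (by rw [h, r_r]))
  rw [r_r, hp.pA] at this
  exact not_A_r _ this

theorem keeps_op' (hp : IsDeck S.A p) (hk : ∀ e, S.Keeps p e) (e : D) : S.op.Keeps p e :=
  (keeps_op hp).2 (hk e)

theorem comm_of_keeps (hp : IsDeck S.A p) (hC : Unsplit S.A) (hk : ∀ e, S.Keeps p e) {e : D}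
    (he : p (S.r e) = S.r (p e)) (f : D) : p (S.r f) = S.r (p f) := by
  refine hC (fun e => p (S.r e) = S.r (p e)) ?_ e f he
  rintro e f (hf | hf) he
  · exact comm_of_To hp hk hf he
  · exact comm_of_To (S := S.op) hp.op (keeps_op' hp hk) (op_To.2 hf) he

end DartSystem
end SimpleGraph

/-! ### Twisting when the two reversals share a value -/

namespace SimpleGraph
open DartSystem
namespace DartSystem

variable {D V W : Type*} {S : DartSystem D V} {T : DartSystem D W}

/-- The orientations of `S` and `T` agree at `e`. -/
def Agree (S : DartSystem D V) (T : DartSystem D W) (e : D) : Prop :=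
  ∀ f, S.A e f → (S.To e f ↔ T.To e f)

theorem Tame.agree (hA : ∀ e f, S.A e f ↔ T.A e f) {e f : D} (he : S.Tame T.r e)
    (hf : S.A e f) (h : S.To e f ↔ T.To e f) : S.Agree T e := by
  intro g hg
  by_cases hfg : f = g
  · rwa [← hfg]
  have h₁ := he.2 f g hf hg hfg
  rw [A_r_iff hf hg hfg, hA, T.A_r_iff ((hA _ _).1 hf) ((hA _ _).1 hg) hfg] at h₁
  tauto

theorem op_Agree (hA : ∀ e f, S.A e f ↔ T.A e f) {e : D} :
    S.Agree T.op e ↔ ∀ f, S.A e f → (S.To e f ↔ ¬ T.To e f) := by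
  refine forall_congr' fun f => forall_congr' fun hf => ?_
  rw [op_To, ← ((hA _ _).1 hf).not_To_iff]

theorem Tame.agree_op (hA : ∀ e f, S.A e f ↔ T.A e f) {e f : D} (he : S.Tame T.r e)
    (hf : S.A e f) (h : ¬ (S.To e f ↔ T.To e f)) : S.Agree T.op e := by
  refine Tame.agree (T := T.op) (by rwa [op_A]) he hf ?_
  rw [op_To, ← ((hA _ _).1 hf).not_To_iff]
  tauto

/-- Reversing both darts of an adjacency always changes its orientation in `S`. Here it is kept in
`T`: `f` and `r (T.r f)` lie on opposite sides of `e` in both systems, and `T.r` sends the latter to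
`r f`. So the systems agree at exactly one of the two adjacencies. -/
theorem Rung.agree_iff_not (hA : ∀ e f, S.A e f ↔ T.A e f) {e f : D} (he : S.Rung T.r e)
    (hf : S.A e f) : ¬ ((S.To f e ↔ T.To f e) ↔
      (S.To (S.r f) (S.r e) ↔ T.To (S.r f) (S.r e))) := by
  have hp := isDeck_of_A hA
  have hq := A_rp hp he.1 hf
  have h₁ : S.To e f ↔ ¬ S.To e (S.r (T.r f)) := by rw [hq.not_To_iff, he.To_iff hf]
  have h₂ : f ≠ S.r (T.r f) := fun h => by
    rw [← h] at h₁; exact iff_not_self h₁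
  have h₃ : T.r (S.r (T.r f)) = S.r f := by
    rw [← T.r_r (S.r f), he.comm hp hf]
  have h₄ := T.A_r_iff ((hA _ _).1 hf) ((hA _ _).1 hq) h₂
  rw [h₃, ← hA, ← not_iff_not] at h₄
  have h₅ := h₄.1 (not_A_r _)
  have h₆ : T.To e f ↔ T.To (S.r e) (S.r f) := by
    rw [← he.1, ← h₃, T.To_r, ← ((hA _ _).1 hq).not_To_iff]
    tauto
  have h₇ := hf.not_To_iff
  have h₈ := ((hA _ _).1 hf).not_To_iff
  have h₉ := ((hA _ _).1 (A_r.2 hf)).not_To_iff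
  rw [To_r, ← h₇, ← h₈, ← h₉, h₆]
  clear * -
  tauto

/-- If both systems reverse some dart in the same way, their graphs are isomorphic. -/
theorem graph_iso_of_common_reversal (hs : S.s.Surjective) (ht : T.s.Surjective)
    (hA : ∀ e f, S.A e f ↔ T.A e f) (hC : Unsplit S.A) {e₀ : D} (he₀ : T.r e₀ = S.r e₀) :
    Nonempty (S.graph ≃g T.graph) := by
  have hp := isDeck_of_A hA
  by_cases hm : S.Match T.r e₀
  · exact graph_iso_of_match hs ht hA hC hm
  obtain ⟨f₀, hf₀, hne⟩ : ∃ f, S.A e₀ f ∧ T.r f ≠ S.r f := by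
    by_contra h
    push Not at h
    exact hm ⟨he₀, h⟩
  have hR := rung_of_unfixed hp he₀ hf₀ hne
  have hRT := rung_or_tame hp hC hR
  have hk : ∀ e, S.Keeps T.r e := fun e => (hRT e).elim (·.2) (·.1)
  have hcomm := comm_of_keeps hp hC hk (e := e₀) (by rw [he₀, r_r, ← he₀, r_r])
  have htame : ∀ e, T.r e ≠ S.r e → S.Tame T.r e := fun e he =>
    (hRT e).resolve_left fun h => he h.1
  -- The darts to be left alone: the orientations agree at `e` and are opposite at `r e`. The rest
  -- is twisted by `T.r ∘ S.r`, which is harmless because a dart outside `I` adjacent to one in `I`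
  -- is fixed by it.
  set I : D → Prop := fun e => S.Agree T e ∧ S.Agree T.op (S.r e) with hI
  have hAr : ∀ {e f}, S.A e f → T.A e f := fun h => (hA _ _).1 h
  -- crossing pairs are reversed alike
  have hcross : ∀ i u, I i → ¬ I u → S.A i u → T.r u = S.r u := by
    intro i u hi hu hiu
    by_contra hne
    refine hu ⟨(htame u hne).agree hA hiu.symm ?_, (htame (S.r u) ?_).agree_op hA
      (A_r.2 hiu.symm) ?_⟩
    · have := hi.1 u hiu
      rw [← hiu.not_To_iff, ← (hAr hiu).not_To_iff, this]
    · rw [hcomm]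
      exact fun h => hne (r_inj.1 h)
    · have h₁ := (op_Agree hA).1 hi.2 (S.r u) (A_r.2 hiu)
      rw [← (A_r.2 hiu).not_To_iff, ← (hAr (A_r.2 hiu)).not_To_iff, h₁]
      tauto
  have hQI : ∀ i, I i → I (T.r (S.r i)) := by
    rintro i ⟨h₁, h₂⟩
    rw [op_Agree hA] at h₂
    refine ⟨fun g hg => ?_, ?_⟩
    · have hg' : S.A (S.r i) (T.r g) := by rwa [← hp.A_p_left]
      have h₃ := h₂ _ hg'
      rw [hk _ _ hg', T.r_r, ← (hAr hg').not_To_iff', not_not, ← T.To_r, T.r_r] at h₃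
      exact h₃
    · rw [op_Agree hA, hcomm, r_r]
      intro g hg
      have hg' : S.A i (T.r g) := by rwa [← hp.A_p_left]
      have h₃ := h₁ _ hg'
      rw [hk _ _ hg', T.r_r, ← (hAr hg').not_To_iff', ← T.To_r, T.r_r] at h₃
      exact h₃
  have hQQ : ∀ e, T.r (S.r (T.r (S.r e))) = e := fun e => by
    rw [hcomm e, r_r, T.r_r]
  obtain ⟨θ, hθ, hθ₁, hθ₂⟩ := exists_partial_perm (A := S.A) (fun _ _ => A.symm) I
    (S.rPerm.trans T.rPerm) (fun e f => (hp.pA _ _).trans A_r)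
    (fun e => by
      simp only [rPerm, Equiv.trans_apply, Equiv.coe_fn_mk]
      refine ⟨fun h => ?_, hQI e⟩
      have := hQI _ h
      rwa [hQQ] at this)
    (fun i u hi hu => by
      simp only [rPerm, Equiv.trans_apply, Equiv.coe_fn_mk]
      constructor <;> intro h
      · rwa [hcomm, hcross i u hi hu h, r_r]
      · have h₁ : ¬ I (T.r (S.r u)) := fun h => hu (by
          have := hQI _ h
          rwa [hQQ] at this)
        have h₂ := hcross _ _ hi h₁ h
        rw [T.r_r, hcomm, r_r] at h₂
        rwa [h₂, T.r_r] at h)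
  simp only [rPerm, Equiv.trans_apply, Equiv.coe_fn_mk] at hθ₂
  have hfix : ∀ e, T.r (S.r e) = e → θ e = e := fun e he => by
    by_cases h : I e
    · exact hθ₁ e h
    · rw [hθ₂ e h, he]
  rw [← T.comap_graph θ]
  have hm : S.Match (T.comap θ).r e₀ := by
    refine ⟨?_, fun f hf => ?_⟩ <;> simp only [comap, Equiv.symm_apply_eq]
    · rw [hfix e₀ (by rw [← he₀, T.r_r]), hfix (S.r e₀) (by rw [r_r, he₀]), he₀]
    · have hf' : S.A (S.r e₀) (S.r f) := A_r.2 hf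
      have t₁ := hR.tame hp hf
      have t₂ := (hR.r hp).tame hp hf'
      have hx := hR.agree_iff_not hA hf
      -- Exactly one of `f` and `r f` is twisted, so the relabelled reversal of `f` is `r f`.
      have hor : (I f ∧ ¬ I (S.r f)) ∨ (I (S.r f) ∧ ¬ I f) := by
        have n₁ : I f → (S.To f e₀ ↔ T.To f e₀) := fun h => h.1 _ hf.symm
        have n₂ : I (S.r f) → ¬ (S.To f e₀ ↔ T.To f e₀) := fun h => by
          have := (op_Agree hA).1 h.2
          rw [r_r] at this
          have := this _ hf.symm
          intro h'
          rw [h'] at this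
          exact iff_not_self this
        by_cases h : S.To f e₀ ↔ T.To f e₀
        · exact .inl ⟨⟨t₁.agree hA hf.symm h, t₂.agree_op hA hf'.symm
            fun h' => hx (iff_of_true h h')⟩, fun h' => n₂ h' h⟩
        · refine .inr ⟨⟨t₂.agree hA hf'.symm ?_, ?_⟩, fun h' => h (n₁ h')⟩
          · by_contra h'
            exact hx (iff_of_false h h')
          · rw [r_r]
            exact t₁.agree_op hA hf.symm h
      rcases hor with ⟨h₁, h₂⟩ | ⟨h₁, h₂⟩
      · rw [hθ₁ f h₁, hθ₂ _ h₂, r_r]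
      · rw [hθ₁ _ h₁, hθ₂ _ h₂, T.r_r]
  exact graph_iso_of_match hs (ht.comp θ.surjective)
    (fun e f => by rw [comap_A, ← hA, hθ]) hC hm

end DartSystem
end SimpleGraph

/-! ### Excluding squares when the reversals agree nowhere -/

namespace SimpleGraph
open DartSystem
namespace DartSystem

variable {D V W : Type*} {S : DartSystem D V} {p : D → D}

/-- In the square `e` is parallel to the walk `p f, p e, p h`. Its reversed darts give new
neighbours of `e` and of `p f`; locating these by `mix_cases` finally yields a dart with three
neighbours on pairwise different `p`-sides. -/
theorem no_square (hp : IsDeck S.A p) (nf : ∀ e, p e ≠ S.r e) {e f h : D} (hf : S.To e f)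
    (hh : S.To h e) (hfh : S.A f (p h)) (a₁ : S.t (p h) = S.t e) (a₂ : S.s (p f) = S.s e)
    (a₃ : S.s (p e) = S.t (p f)) (a₄ : S.t (p e) = S.s (p h)) : False := by
  have c₁ := (hp.pA e f).2 (.inl hf)
  have c₂ := (hp.pA e h).2 (.inr hh)
  have hs : ∀ e f, S.A e f → S.A f e := fun _ _ => A.symm
  have hk : S.To e (S.r (p h)) := by
    simp only [A, To, S.s_r, S.t_r] at *; grind
  have hl : S.To (S.r (p f)) e := by
    simp only [A, To, S.s_r, S.t_r] at *; grind
  have hkh : ¬ S.A (S.r (p h)) (p h) := fun h => not_A_r _ h.symm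
  have hlf : ¬ S.A (S.r (p f)) (p f) := fun h => not_A_r _ h.symm
  have hfk : f ≠ S.r (p h) := fun h' => hkh (h' ▸ hfh)
  have hlf' : S.r (p f) ≠ f := fun h' => nf f (r_eq_iff.1 h')
  have hkf : ¬ S.A (S.r (p h)) (p f) := fun h' =>
    hkh (hp.trans e _ f h (.inl hk) (.inl hf) (.inr hh)
      (fun h'' => nf h (r_eq_iff.1 h'')) h' hfh)
  -- With `k = r (p h)` and `l = r (p f)`: neither `k` nor `l` is on the common `p`-side of `f` and
  -- `h`, so they share the other one.
  have hkl : S.A (S.r (p h)) (p (S.r (p f))) := by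
    by_contra hne
    rcases hp.two e (S.r (p h)) (S.r (p f)) f (.inl hk) (.inr hl) (.inl hf)
      (fun h => To.asymm hk (h ▸ hl)) hlf' (Ne.symm hfk) with h' | h' | h'
    · exact hne h'
    · exact hlf h'
    · exact hkf h'
  have b₁ := (hp.pA e _).2 (.inl hk)
  have b₂ := (hp.pA e _).2 (.inr hl)
  have hL : S.s (p (S.r (p f))) = S.t (S.r (p h)) ∧ S.t (p (S.r (p h))) = S.s (S.r (p f)) := by
    have := mix_cases hp hk hl hkl
    have := nf e
    have := S.s_ne_t e
    simp only [A, To, S.s_r, S.t_r] at *; grind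
  obtain ⟨hL₁, hL₂⟩ := hL
  have hlk := hp.swap hs hkl
  have hjm : S.To (S.r e) (p f) := by
    simp only [A, To, S.s_r, S.t_r] at *; grind
  have hmi : S.To (p f) (S.r (p (S.r (p h)))) := by
    simp only [A, To, S.s_r, S.t_r] at *; grind
  have hie : ¬ S.A (S.r (p (S.r (p h)))) e := by
    have := S.s_ne_t e
    simp only [A, To, S.s_r, S.t_r] at *; grind
  have hipe : S.r (p (S.r (p h))) ≠ p e := by
    intro h
    rw [r_eq_iff] at h
    rw [h] at b₁
    exact not_A_r _ b₁
  -- The same argument at `p f`, with the neighbours `r (p k)`, `r e` and `p e`.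
  have hij : S.A (S.r (p (S.r (p h)))) (p (S.r e)) := by
    rcases hp.two (p f) _ (S.r e) (p e) (.inl hmi) (.inr hjm) c₁.symm
      (fun h => To.asymm hjm (h ▸ hmi)) (nf e).symm hipe with h' | h' | h'
    · exact h'
    · rw [hp.pp] at h'
      exact absurd h'.symm (not_A_r _)
    · rw [hp.pp] at h'
      exact absurd h' hie
  have hm := mix_cases hp hmi hjm hij
  rw [hp.pp] at hm
  generalize hi : S.r (p (S.r (p h))) = i at *
  have hi' : i ≠ p (S.r (p h)) := hi ▸ r_ne _
  have d₁ := (hp.pA _ _).2 (.inl hmi)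
  rw [hp.pp] at d₁
  have hpie : p i ≠ e := fun h => hipe (by rw [← h, hp.pp])
  have hpif : p i ≠ S.r f := fun h => not_A_r f (h ▸ d₁)
  have hsi : S.s i = S.t (p (S.r (p h))) := by rw [← hi, S.s_r]
  have hti : S.t i = S.s (p (S.r (p h))) := by rw [← hi, S.t_r]
  have hmi₁ := hmi.1
  have hm' : (S.t (p i) = S.t e ∧ S.t f = S.t i) ∨
      (S.s (p (S.r e)) = S.t f ∧ S.t (p (S.r e)) = S.t (p f)) := by
    have e₁ := S.ext (p i) e
    have e₂ := S.ext (p i) (S.r f)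
    have := nf f
    have := hf.1
    clear hi hie hij hipe hkl hlk hkh hlf hfk hkf b₁ b₂ c₁ c₂ d₁
    simp only [S.s_r, S.t_r] at *
    grind
  -- The three separated neighbours are `r (p i)`, `r (p h)`, `f` around `e` in the first case, and
  -- `r (p (r e))`, `r e`, `p e` around `p f` in the second.
  rcases hm' with ⟨g₁, g₂⟩ | ⟨g₁, g₂⟩
  · have hn : S.To e (S.r (p i)) := by
      refine ⟨by rw [S.s_r, g₁], fun h' => hpie (S.ext _ _ ?_ g₁)⟩
      rw [h', S.t_r]
    have hni : ¬ S.A (S.r (p i)) (p (S.r (p h))) := by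
      rw [r_eq_iff.1 hi, A_r]
      exact fun h' => hp.pn _ h'.symm
    have hih : S.r (p i) ≠ S.r (p h) := fun h' => hie (by
      rw [hp.inj (r_inj.1 h')]
      exact .inl hh)
    rcases hp.two e (S.r (p i)) (S.r (p h)) f (.inl hn) (.inl hk) (.inl hf)
      hih hfk.symm (fun h' => hpif (r_eq_iff.1 h')) with h' | h' | h'
    · exact hni h'
    · exact hkf h'
    · have := S.s_ne_t e
      clear hi hie hij hipe hkl hlk hkh hlf hfk hkf b₁ hm
      simp only [A, To, S.s_r, S.t_r] at *; grind
  · have hn : S.To (p f) (S.r (p (S.r e))) := by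
      refine ⟨by rw [S.s_r, g₂], ?_⟩
      rw [S.t_r, g₁, a₂]
      exact hf.2
    have hne : S.r (p (S.r e)) ≠ p e := fun h' => hfk (S.ext _ _ (by rw [S.s_r, a₁, hf.1])
      (by rw [S.t_r, ← a₄, ← h', S.t_r, g₁]))
    rcases hp.two (p f) (S.r (p (S.r e))) (S.r e) (p e) (.inl hn) (.inr hjm) c₁.symm
      (fun h' => nf _ (r_eq_iff.1 h')) (nf e).symm hne with h' | h' | h'
    · exact not_A_r _ h'.symm
    · rw [hp.pp] at h'
      exact absurd h'.symm (not_A_r _)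
    · rw [hp.pp] at h'
      have := S.s_ne_t e
      clear hi hie hij hipe hkl hlk hkh hlf hfk hkf b₁ hm
      simp only [A, To, S.s_r, S.t_r] at *; grind

/-- The position of two darts which leave `e` on the same side. -/
theorem src_D (hp : IsDeck S.A p) (nf : ∀ e, p e ≠ S.r e) {e f g : D} (hf : S.To e f)
    (hg : S.To e g) (hfg : f ≠ g) (h : S.A f (p g)) :
    S.s (p f) = S.t g ∧ S.s (p g) = S.t f ∧ S.t (p f) = S.s (p e) ∧ S.t (p g) = S.s (p e) := by
  have hs : ∀ e f, S.A e f → S.A f e := fun _ _ => A.symm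
  -- The exceptional alternatives of `src_cases` are a forbidden square centred at `g`, left by `p
  -- f` and entered by `e`.
  have key : ∀ f g, S.To e f → S.To e g → S.A f (p g) → S.s (p f) = S.t g → S.s (p g) = S.t f →
      S.t (p g) = S.s (p e) → S.t (p e) = S.t g → False := by
    intro f g hf hg h a₁ a₂ a₃ a₄
    refine no_square hp nf (e := g) (f := p f) (h := e) ?_ hg
      ((hp.pA _ _).2 (.inr hf)) a₄ ?_ ?_ a₃
    · refine (hp.swap hs h).resolve_right fun h' => ?_
      simp only [To] at *; grind
    · rw [hp.pp, ← hf.1, hg.1]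
    · rw [hp.pp, a₂]
  rcases src_cases hp hf hg hfg h with h' | h' | h' | h' | ⟨b₁, b₂, b₃, b₄⟩ | ⟨b₁, b₂, b₃, b₄⟩
  · exact absurd h' (nf e)
  · exact absurd h' (nf f)
  · exact absurd h' (nf g)
  · exact h'
  · exact (key f g hf hg h b₁ b₂ b₃ b₄).elim
  · exact (key g f hg hf (hp.swap hs h) b₂ b₁ b₃ b₄).elim

/-- The position of two darts which enter and leave `e` on the same side. -/
theorem mix_BD (hp : IsDeck S.A p) (nf : ∀ e, p e ≠ S.r e) {e f h : D} (hf : S.To e f)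
    (hh : S.To h e) (hfh : S.A f (p h)) :
    (S.s (p h) = S.t f ∧ S.t (p f) = S.s h ∧ S.s (p e) = S.t (p h) ∧ S.t (p e) = S.s (p f)) ∨
    (S.t (p h) = S.t e ∧ S.t (p f) = S.s h ∧ S.s (p e) = S.s h ∧ S.t (p e) = S.s (p h)) ∨
    (S.s (p h) = S.t f ∧ S.s (p f) = S.s e ∧ S.s (p e) = S.t (p f) ∧ S.t (p e) = S.t f) := by
  have hs : ∀ e f, S.A e f → S.A f e := fun _ _ => A.symm
  have h₀ := hp.swap hs hfh
  have h₁ := (hp.pA e f).2 (.inl hf)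
  have h₂ := (hp.pA e h).2 (.inr hh)
  -- The alternatives that are squares are centred at `e`, `p e`, `p h` and `p f` respectively.
  rcases mix_cases hp hf hh hfh with h' | ⟨b₁, b₂, b₃, b₄⟩ | h' | ⟨b₁, b₂, b₃, b₄⟩ | h' |
    ⟨b₁, b₂, b₃, b₄⟩ | h' | ⟨b₁, b₂, b₃, b₄⟩
  · exact absurd h' (nf e)
  · exact (no_square hp nf hf hh hfh b₁ b₂ b₃ b₄).elim
  · exact .inl h'
  · refine (no_square hp nf (e := p e) (f := p h) (h := p f) ?_ ?_ ?_ ?_ ?_ ?_ ?_).elim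
    · refine h₂.resolve_right fun h => ?_
      simp only [A, To] at *; grind
    · refine h₁.resolve_left fun h => ?_
      simp only [A, To] at *; grind
    · rw [hp.pp]; exact hs _ _ hfh
    · rw [hp.pp, b₄]
    · rw [hp.pp, b₃]
    · rw [hp.pp, hp.pp, hh.1]
    · rw [hp.pp, hp.pp, hf.1]
  · exact .inr (.inl h')
  · refine (no_square hp nf (e := p h) (f := f) (h := p e) ?_ ?_ ?_ ?_ ?_ ?_ ?_).elim
    · refine hfh.symm.resolve_right fun h => ?_
      simp only [A, To] at *; grind
    · refine h₂.resolve_right fun h => ?_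
      simp only [A, To] at *; grind
    · rw [hp.pp]; exact .inr hf
    · rw [hp.pp, b₁]
    · rw [b₃]
    · rw [hp.pp, b₂]
    · rw [hp.pp, hp.pp, hh.1]
  · exact .inr (.inr h')
  · refine (no_square hp nf (e := p f) (f := p e) (h := h) ?_ ?_ ?_ ?_ ?_ ?_ ?_).elim
    · refine h₁.resolve_left fun h => ?_
      simp only [A, To] at *; grind
    · refine h₀.resolve_right fun h => ?_
      simp only [A, To] at *; grind
    · exact (hp.pA _ _).2 (.inr hh)
    · rw [b₃]
    · rw [hp.pp, b₂]
    · rw [hp.pp, hp.pp, hf.1]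
    · rw [hp.pp, b₁]

end DartSystem
end SimpleGraph

/-! ### Deterministic walks never meet their reversal -/

namespace SimpleGraph
open DartSystem

/-- Reversal makes `R` injective as well, so connected elements are joined by a directed chain. A
chain from `x` to `r x` shortens at both ends to one from `y` to `r y`, down to length zero or one,
where none exists. -/
theorem not_eqvGen_of_functional {D : Type*} {R : D → D → Prop} {r : D → D}
    (hR : ∀ x y z, R x y → R x z → y = z) (hr : ∀ x, r (r x) = x)
    (hRr : ∀ x y, R x y → R (r y) (r x)) (h₀ : ∀ x, r x ≠ x) (h₁ : ∀ x, ¬ R x (r x)) (x : D) :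
    ¬ Relation.EqvGen R x (r x) := by
  have hinj : ∀ x y z, R x z → R y z → x = y := fun x y z hx hy => by
    have := hR _ _ _ (hRr _ _ hx) (hRr _ _ hy)
    rw [← hr x, this, hr]
  -- `C n` is the existence of a chain of exactly `n` steps.
  let C : ℕ → D → D → Prop := fun n => Nat.rec (fun x y => x = y)
    (fun _ c x y => ∃ z, R x z ∧ c z y) n
  have hlast : ∀ n x y, C (n + 1) x y → ∃ z, C n x z ∧ R z y := by
    intro n
    induction n with
    | zero => rintro x y ⟨z, h, rfl⟩; exact ⟨x, rfl, h⟩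
    | succ n ih =>
      rintro x y ⟨z, h, h'⟩
      obtain ⟨w, h₂, h₃⟩ := ih z y h'
      exact ⟨w, ⟨z, h, h₂⟩, h₃⟩
  have key : ∀ n x, ¬ C n x (r x) := by
    intro n
    induction n using Nat.twoStepInduction with
    | zero => exact fun x h => h₀ x (Eq.symm h)
    | one => rintro x ⟨z, h, rfl⟩; exact h₁ x h
    | more n ih _ =>
      rintro x ⟨y, h, h'⟩
      obtain ⟨z, h₂, h₃⟩ := hlast n y _ h'
      have h₄ := hRr _ _ h₃
      rw [hr] at h₄
      rw [← hr z, ← hR _ _ _ h h₄] at h₂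
      exact ih y h₂
  have hC : ∀ n x y z, C n x y → R y z → C (n + 1) x z := by
    intro n
    induction n with
    | zero => rintro x y z rfl h; exact ⟨z, h, rfl⟩
    | succ n ih => rintro x y z ⟨w, h, h'⟩ h''; exact ⟨w, h, ih _ _ _ h' h''⟩
  have htot : ∀ x y, Relation.EqvGen R x y → (∃ n, C n x y) ∨ ∃ n, C n y x := by
    intro x y h
    have : ∀ z w, R z w → (((∃ n, C n x z) ∨ ∃ n, C n z x) ↔
        ((∃ n, C n x w) ∨ ∃ n, C n w x)) := by
      intro z w hzw
      constructor
      · rintro (⟨n, h⟩ | ⟨n, h⟩)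
        · exact .inl ⟨n + 1, hC _ _ _ _ h hzw⟩
        · cases n with
          | zero => obtain rfl : z = x := h; exact .inl ⟨1, w, hzw, rfl⟩
          | succ n =>
            obtain ⟨y, h₂, h₃⟩ := h
            rw [hR _ _ _ h₂ hzw] at h₃
            exact .inr ⟨n, h₃⟩
      · rintro (⟨n, h⟩ | ⟨n, h⟩)
        · cases n with
          | zero => obtain rfl : x = w := h; exact .inr ⟨1, _, hzw, rfl⟩
          | succ n =>
            obtain ⟨y, h₂, h₃⟩ := hlast _ _ _ h
            rw [hinj _ _ _ h₃ hzw] at h₂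
            exact .inl ⟨n, h₂⟩
        · exact .inr ⟨n + 1, w, hzw, h⟩
    have h' : ∀ z w, Relation.EqvGen R z w → (((∃ n, C n x z) ∨ ∃ n, C n z x) ↔
        ((∃ n, C n x w) ∨ ∃ n, C n w x)) := by
      intro z w h
      induction h with
      | rel _ _ h => exact this _ _ h
      | refl => exact Iff.rfl
      | symm _ _ _ ih => exact ih.symm
      | trans _ _ _ _ _ h h' => exact h.trans h'
    exact (h' x y h).1 (.inl ⟨0, rfl⟩)
  intro h
  rcases htot _ _ h with ⟨n, h⟩ | ⟨n, h⟩
  · exact key n x h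
  · refine key n (r x) ?_
    rwa [hr]

/-- If a symmetric nonbacktracking relation is functional modulo an equivalence, no element is
connected to its reversal. -/
theorem not_eqvGen_of_functional_mod {D : Type*} {R : D → D → Prop} {r : D → D} (E : Setoid D)
    (hR : ∀ x x' y z, R x y → R x' z → E x x' → E y z) (hr : ∀ x, r (r x) = x)
    (hRr : ∀ x y, R x y → R (r y) (r x)) (hEr : ∀ x y, E x y → E (r x) (r y))
    (h₀ : ∀ x, ¬ E (r x) x) (h₁ : ∀ x y, R x y → ¬ E y (r x)) (x : D) :
    ¬ Relation.EqvGen (fun x y => R x y ∨ E x y) x (r x) := by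
  intro h
  let R' : Quotient E → Quotient E → Prop := fun a b => ∃ x y, R x y ∧ ⟦x⟧ = a ∧ ⟦y⟧ = b
  let r' : Quotient E → Quotient E := Quotient.map r hEr
  refine not_eqvGen_of_functional (R := R') (r := r') ?_ ?_ ?_ ?_ ?_ ⟦x⟧ ?_
  · rintro _ _ _ ⟨x, y, hxy, rfl, rfl⟩ ⟨x', y', hxy', hx, rfl⟩
    exact Quotient.sound (hR _ _ _ _ hxy hxy' (E.symm (Quotient.exact hx)))
  · rintro ⟨x⟩
    exact congrArg (Quotient.mk E) (hr x)
  · rintro _ _ ⟨x, y, h, rfl, rfl⟩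
    exact ⟨_, _, hRr _ _ h, rfl, rfl⟩
  · rintro ⟨x⟩ h
    exact h₀ x (Quotient.exact h)
  · rintro ⟨x⟩ ⟨y, z, h, hy, hz⟩
    exact h₁ y z h (E.trans (Quotient.exact hz) (hEr _ _ (E.symm (Quotient.exact hy))))
  · have : ∀ x y, Relation.EqvGen (fun x y => R x y ∨ E x y) x y →
        Relation.EqvGen R' (⟦x⟧ : Quotient E) ⟦y⟧ := by
      intro x y h
      induction h with
      | rel a b h =>
        rcases h with h | h
        · exact .rel _ _ ⟨a, b, h, rfl, rfl⟩
        · rw [Quotient.sound h]; exact .refl _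
      | refl => exact .refl _
      | symm _ _ _ ih => exact .symm _ _ ih
      | trans _ _ _ _ _ h h' => exact .trans _ _ _ h h'
    exact this _ _ h

/-! ### Hexagons, and reversal of orientation in their absence -/

namespace DartSystem

variable {D V W : Type*} {S : DartSystem D V} {p : D → D}

/-- A hexagon on which `p` acts as the rotation by a half turn. -/
def Hex (S : DartSystem D V) (p : D → D) (e f g : D) : Prop :=
  S.To e f ∧ S.To f g ∧ S.To g (p e) ∧ S.To (p e) (p f) ∧ S.To (p f) (p g) ∧ S.To (p g) e

theorem mix_hex_or (hp : IsDeck S.A p) (nf : ∀ e, p e ≠ S.r e) {e f h : D} (hf : S.To e f)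
    (hh : S.To h e) (hfh : S.A f (p h)) : S.Hex p e f (p h) ∨
    (S.t (p h) = S.t e ∧ S.t (p f) = S.s h ∧ S.s (p e) = S.s h ∧ S.t (p e) = S.s (p h)) ∨
    (S.s (p h) = S.t f ∧ S.s (p f) = S.s e ∧ S.s (p e) = S.t (p f) ∧ S.t (p e) = S.t f) := by
  refine (mix_BD hp nf hf hh hfh).imp_left ?_
  rintro ⟨b₁, b₂, b₃, b₄⟩
  have h₁ := (hp.pA e f).2 (.inl hf)
  have h₂ := (hp.pA e h).2 (.inr hh)
  have h₃ := hp.swap (fun _ _ => A.symm) hfh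
  simp only [Hex, hp.pp]
  simp only [A, To] at *
  grind

theorem hex_op {e f g : D} (hp : IsDeck S.A p) (h : S.op.Hex p e f g) :
    S.Hex p e (p g) (p f) := by
  simp only [Hex, op_To, hp.pp] at *
  tauto

/-- `p` reverses the orientation of the adjacency of `e` and `f`. -/
def Flips (S : DartSystem D V) (p : D → D) (e f : D) : Prop := S.To e f ↔ S.To (p f) (p e)

theorem flips_op (hp : IsDeck S.A p) {e f : D} (h : S.A e f) :
    S.op.Flips p e f ↔ S.Flips p e f := by
  unfold Flips
  rw [op_To, op_To, ← h.not_To_iff, ← ((hp.pA _ _).2 h).not_To_iff']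
  tauto

theorem flips_comm (hp : IsDeck S.A p) {e f : D} (h : S.A e f) :
    S.Flips p e f ↔ S.Flips p f e := by
  unfold Flips
  rw [← h.not_To_iff, ← ((hp.pA _ _).2 h).not_To_iff']
  tauto

theorem flips_of_To {e f : D} (h : S.To f e) (h' : S.To (p e) (p f)) :
    S.Flips p e f := iff_of_false h.asymm h'.asymm

section generic

variable (hp : IsDeck S.A p) (nf : ∀ e, p e ≠ S.r e) (nb : ∀ e f g, ¬ S.Hex p e f g)
include hp nf

theorem mix_cases' (nb : ∀ e f g, ¬ S.Hex p e f g) {e f h : D} (hf : S.To e f) (hh : S.To h e)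
    (hfh : S.A f (p h)) :
    (S.t (p h) = S.t e ∧ S.t (p f) = S.s h ∧ S.s (p e) = S.s h ∧ S.t (p e) = S.s (p h)) ∨
    (S.s (p h) = S.t f ∧ S.s (p f) = S.s e ∧ S.s (p e) = S.t (p f) ∧ S.t (p e) = S.t f) :=
  (mix_hex_or hp nf hf hh hfh).resolve_left (nb _ _ _)

theorem flip_of_mix (nb : ∀ e f g, ¬ S.Hex p e f g) {e f h : D} (hf : S.To e f) (hh : S.To h e)
    (hfh : S.A f (p h)) : S.To (p f) (p e) ∧ S.To (p e) (p h) := by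
  have h₁ := (hp.pA e f).2 (.inl hf)
  have h₂ := (hp.pA e h).2 (.inr hh)
  have := mix_cases' hp nf nb hf hh hfh
  simp only [A, To] at *
  grind

theorem flip_of_src {e f g : D} (hf : S.To e f) (hg : S.To e g) (hfg : f ≠ g)
    (h : S.A f (p g)) : S.To (p f) (p e) := by
  have h₁ := (hp.pA e f).2 (.inl hf)
  have := src_D hp nf hf hg hfg h
  simp only [A, To] at *
  grind

/-- In every position left by `src_D` and `mix_cases'`, the images under `p` are traversed in the
opposite order. -/
theorem flips_of_side (nb : ∀ e f g, ¬ S.Hex p e f g) {e f g : D} (hf : S.A e f) (hg : S.A e g)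
    (hfg : f ≠ g) (h : S.A f (p g)) : S.Flips p e f := by
  have h' := hp.swap (fun _ _ => A.symm) h
  rcases hf with hf | hf <;> rcases hg with hg | hg
  · exact iff_of_true hf (flip_of_src hp nf hf hg hfg h)
  · exact iff_of_true hf (flip_of_mix hp nf nb hf hg h).1
  · exact flips_of_To hf (flip_of_mix hp nf nb hg hf h').2
  · exact flips_of_To hf (op_To.1 (flip_of_src (S := S.op) hp.op nf (op_To.2 hf)
      (op_To.2 hg) hfg (by rwa [op_A])))

/-- If two darts on the same side of `e` are on different sides in the other structure, the
dart `e` has a further neighbour. -/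
theorem A_p_r_of_mix (nb : ∀ e f g, ¬ S.Hex p e f g) {e f h : D} (hf : S.To e f)
    (hh : S.To h e) (hfh : S.A f (p h)) : S.A e (S.r (p f)) ∨ S.A e (S.r (p h)) := by
  have h₁ := (hp.pA e f).2 (.inl hf)
  have h₂ := (hp.pA e h).2 (.inr hh)
  have := mix_cases' hp nf nb hf hh hfh
  have h₃ := hp.swap (fun _ _ => A.symm) hfh
  have e₁ : p e ≠ f := fun h => hp.pn e (h ▸ .inl hf)
  have e₂ : p e ≠ h := fun h => hp.pn e (h ▸ .inr hh)
  have e₃ := S.ext (p e) f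
  have e₄ := S.ext (p e) h
  simp only [A, To, S.s_r, S.t_r] at *
  grind

/-- Only a `g` not on the `p`-side of `f` is new. As `e` and `r g` enter `f` on the same `p`-side,
`src_D` locates `k = p (r g)`. Then `p (r k)` is a neighbour of `e` separated from `f`, so it equals
`g` or shares its `p`-side. -/
theorem flips_of_src_To (nb : ∀ e f g, ¬ S.Hex p e f g) {e f f' g : D} (hf : S.To e f)
    (hf' : S.To e f') (hff : f ≠ f') (h : S.A f (p f')) (hg : S.To e g) :
    S.Flips p e g := by
  have hs : ∀ e f, S.A e f → S.A f e := fun _ _ => A.symm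
  by_cases hgf : f = g
  · rw [← hgf]; exact flips_of_side hp nf nb (.inl hf) (.inl hf') hff h
  by_cases hgs : S.A f (p g)
  · exact flips_of_side hp nf nb (.inl hg) (.inl hf) (Ne.symm hgf) (hp.swap hs hgs)
  have hgf' : f' ≠ g := fun h' => hgs (h' ▸ h)
  obtain ⟨a₁, a₂, a₃, a₄⟩ := src_D hp nf hf hf' hff h
  have h' := hp.swap hs h
  have c₁ := (hp.pA e f).2 (.inl hf)
  have hrg : S.To (S.r g) f := by
    have := S.ext f g
    simp only [To, S.s_r, S.t_r] at *; grind
  -- `r g` and `e` lie on the same side of `f`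
  have hside : S.A e (p (S.r g)) := by
    have b₁ : S.A f (p f') := h
    have hrf' : S.To (S.r f') f := by
      have := S.ext f f'
      simp only [To, S.s_r, S.t_r] at *; grind
    have b₂ : ¬ S.A (S.r f') (p (p f')) := fun h => not_A_r _ (by rw [hp.pp] at h; exact h.symm)
    have b₃ : S.A (S.r g) (p (p f')) := by
      rw [hp.pp]
      have := S.ext g f'
      simp only [A, To, S.s_r, S.t_r] at *; grind
    have b₄ : S.A e (p (p f')) := by rw [hp.pp]; exact .inl hf'
    have b₅ : e ≠ S.r g := fun h => not_A_r g (.inr (h ▸ hg))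
    exact hp.trans f e (p f') (S.r g) (.inr hf) b₁ (.inr hrg) b₅ b₄ (hp.swap hs b₃)
  have hsrc := src_D (S := S.op) hp.op nf (e := f) (f := e) (g := S.r g) (op_To.2 hf)
    (op_To.2 hrg) (fun h => not_A_r g (.inr (h ▸ hg))) (by rwa [op_A])
  change S.t (p e) = S.s (S.r g) ∧ S.t (p (S.r g)) = S.s e ∧ S.s (p e) = S.t (p f) ∧
    S.s (p (S.r g)) = S.t (p f) at hsrc
  rw [S.s_r] at hsrc
  obtain ⟨d₁, d₂, d₃, d₄⟩ := hsrc
  set k := p (S.r g) with hk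
  have hfp : S.To f' (p f) := by
    refine h'.resolve_right fun h => ?_
    simp only [To] at *; grind
  have hhe : S.To k e := by
    simp only [To] at *; grind
  have hkf : S.A f (p k) := by rw [hk, hp.pp]; exact .inr hrg
  have hrk : S.To (S.r k) (p e) := by
    simp only [To, S.s_r, S.t_r] at *; grind
  have hprk : S.A e (p (S.r k)) := by rw [← hp.A_p_left]; exact .inr hrk
  have hkk : ¬ S.A k (S.r k) := not_A_r k
  have hfrk : ¬ S.A f (S.r k) := fun h'' => hkk (by
    have := hp.trans e k f (p (S.r k)) (.inr hhe) (.inl hf) hprk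
      (fun h => nf (S.r k) (by rw [r_r]; exact h.symm)) (hp.swap hs hkf) (by rwa [hp.pp])
    rwa [hp.pp] at this)
  by_cases hgg : p (S.r k) = g
  · refine iff_of_true hg ?_
    rwa [← hgg, hp.pp]
  · refine flips_of_side hp nf nb (.inl hg) hprk (Ne.symm hgg) ?_
    rcases hp.two e f g (p (S.r k)) (.inl hf) (.inl hg) hprk hgf (Ne.symm hgg)
      (fun h => hkk (by
        have h₁ := hp.swap hs hkf
        rwa [h, hp.pp] at h₁)) with h | h | h
    · exact absurd h hgs
    · exact h
    · rw [hp.pp] at h; exact absurd h hfrk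

end generic

end DartSystem
end SimpleGraph

/-! ### Reversal of orientation spreads to all darts -/

namespace SimpleGraph
open DartSystem
namespace DartSystem

variable {D V W : Type*} {S : DartSystem D V} {T : DartSystem D W} {p : D → D}

section generic

variable (hp : IsDeck S.A p) (nf : ∀ e, p e ≠ S.r e) (nb : ∀ e f g, ¬ S.Hex p e f g)
include hp nf nb

omit nf in
theorem noHex_op : ∀ e f g, ¬ S.op.Hex p e f g := fun _ _ _ h => nb _ _ _ (hex_op hp h)

/-- For `g` entering `e`, a failure would make `p g` enter `p e` together with `p f` and `p f'`;
then `flips_of_src_To` for the opposite system at `p e` gives a contradiction. -/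
theorem flips_of_src_A {e f f' g : D} (hf : S.To e f) (hf' : S.To e f') (hff : f ≠ f')
    (h : S.A f (p f')) (hg : S.A e g) : S.Flips p e g := by
  rcases hg with hg | hg
  · exact flips_of_src_To hp nf nb hf hf' hff h hg
  by_contra hne
  have hAg : S.A e g := .inr hg
  have h₁ : S.To (p g) (p e) := by
    by_contra h'
    exact hne (iff_of_false hg.asymm h')
  have k₁ := (flips_of_side hp nf nb (.inl hf) (.inl hf') hff h).1 hf
  have k₂ := (flips_of_side hp nf nb (.inl hf') (.inl hf) hff.symm
    (hp.swap (fun _ _ => A.symm) h)).1 hf'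
  have := flips_of_src_To (S := S.op) hp.op nf (noHex_op hp nb) (op_To.2 k₁) (op_To.2 k₂)
    (fun h => hff (hp.inj h)) (by rw [op_A, hp.pA]; exact h) (op_To.2 h₁)
  rw [flips_op hp (.inr h₁)] at this
  unfold Flips at this
  rw [hp.pp, hp.pp] at this
  exact h₁.asymm (this.2 hg)

/-- The darts `r (p f)` and `p (r f)` are neighbours of `e` not on the `p`-side of `f`; unless `g`
equals both, it shares its `p`-side with one of them. -/
theorem flips_of_mix_aux {e f g : D} (hf : S.To e f) (hg : S.A e g) (hgf : ¬ S.A g (p f)) (hfg : f ≠ g) (a₂ : S.s (p f) = S.s e)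
    (a₃ : S.s (p e) = S.t (p f)) (a₄ : S.t (p e) = S.t f) : S.Flips p e g := by
  have hs : ∀ e f, S.A e f → S.A f e := fun _ _ => A.symm
  have e₁ : p e ≠ f := fun h => hp.pn e (h ▸ .inl hf)
  have e₃ := S.ext (p e) f
  have hk : S.To (S.r (p f)) e := by
    simp only [A, To, S.s_r, S.t_r] at *
    grind
  have hrf : S.To (p e) (S.r f) := by
    simp only [A, To, S.s_r, S.t_r] at *
    grind
  have hkf : ¬ S.A (S.r (p f)) (p f) := fun h => not_A_r _ h.symm
  have hfk : f ≠ S.r (p f) := fun h => nf f (r_eq_iff.1 h.symm)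
  have hprf : S.A e (p (S.r f)) := by rw [← hp.A_p_left]; exact .inl hrf
  have hprf' : ¬ S.A f (p (p (S.r f))) := by rw [hp.pp]; exact not_A_r f
  have hfprf : f ≠ p (S.r f) := fun h => nf f (by
    conv_lhs => rw [h]
    exact hp.pp _)
  by_cases hgk : g = S.r (p f)
  · by_cases hgg : p (S.r f) = g
    · refine flips_of_To (hgk ▸ hk) ?_
      rwa [← hgg, hp.pp]
    · refine flips_of_side hp nf nb hg hprf (Ne.symm hgg) ?_
      rcases hp.two e f g (p (S.r f)) (.inl hf) hg hprf hfg (Ne.symm hgg) hfprf with h | h | h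
      · exact absurd (hp.swap hs h) hgf
      · exact h
      · exact absurd h hprf'
  · refine flips_of_side hp nf nb hg (.inr hk) hgk ?_
    rcases hp.two e f g _ (.inl hf) hg (.inr hk) hfg hgk hfk with h | h | h
    · exact absurd (hp.swap hs h) hgf
    · exact h
    · exact absurd (hp.swap hs h) hkf

theorem flips_of_mix_A {e f h g : D} (hf : S.To e f) (hh : S.To h e) (hfh : S.A f (p h))
    (hg : S.A e g) : S.Flips p e g := by
  have hs : ∀ e f, S.A e f → S.A f e := fun _ _ => A.symm
  have hhf := hp.swap hs hfh
  have hne : f ≠ h := fun h' => hh.asymm (h' ▸ hf)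
  by_cases hfg : f = g
  · rw [← hfg]; exact flips_of_side hp nf nb (.inl hf) (.inr hh) hne hfh
  by_cases hhg : h = g
  · rw [← hhg]; exact flips_of_side hp nf nb (.inr hh) (.inl hf) hne.symm hhf
  by_cases hgf : S.A g (p f)
  · exact flips_of_side hp nf nb hg (.inl hf) (Ne.symm hfg) hgf
  by_cases hgh : S.A g (p h)
  · exact flips_of_side hp nf nb hg (.inr hh) (Ne.symm hhg) hgh
  rcases mix_cases' hp nf nb hf hh hfh with ⟨a₁, a₂, a₃, a₄⟩ | ⟨a₁, a₂, a₃, a₄⟩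
  · rw [← flips_op hp hg]
    exact flips_of_mix_aux (S := S.op) hp.op nf (noHex_op hp nb) (op_To.2 hh) (by rwa [op_A]) (by rwa [op_A]) hhg a₁ a₄ a₃
  · exact flips_of_mix_aux hp nf nb hf hg hgf hfg a₂ a₃ a₄

theorem flips_of_sides {e f f' g : D} (hf : S.A e f) (hf' : S.A e f') (hff : f ≠ f')
    (h : S.A f (p f')) (hg : S.A e g) : S.Flips p e g := by
  have h' := hp.swap (fun _ _ => A.symm) h
  rcases hf with hf | hf <;> rcases hf' with hf' | hf'
  · exact flips_of_src_A hp nf nb hf hf' hff h hg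
  · exact flips_of_mix_A hp nf nb hf hf' h hg
  · exact flips_of_mix_A hp nf nb hf' hf h' hg
  · rw [← flips_op hp hg]
    exact flips_of_src_A (S := S.op) hp.op nf (noHex_op hp nb) (op_To.2 hf)
      (op_To.2 hf') hff (by rwa [op_A]) (by rwa [op_A])

/-- If no two neighbours of `e` share a `p`-side, then `f` and `g` are all of them. By `H` they are
on opposite sides of `e`, and `p f`, `p g` on opposite sides of `p e`, so the behaviour at `f`
decides that at `g`. -/
theorem flips_of_flips (H : ∀ m m₁ m₂, S.A m m₁ → S.A m m₂ → m₁ ≠ m₂ → ¬ S.A m₁ (p m₂) →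
      (S.To m m₁ ↔ S.To m m₂) → ∃ m₃, S.A m m₃ ∧ m₃ ≠ m₁ ∧ m₃ ≠ m₂)
    {e f g : D} (hf : S.A e f) (hg : S.A e g) (hef : S.Flips p e f) : S.Flips p e g := by
  by_cases hfg : f = g
  · rwa [← hfg]
  by_cases hn : ∃ a b, S.A e a ∧ S.A e b ∧ a ≠ b ∧ S.A a (p b)
  · obtain ⟨a, b, ha, hb, hab, h⟩ := hn
    exact flips_of_sides hp nf nb ha hb hab h hg
  push Not at hn
  have h₂ : ∀ k, S.A e k → k = f ∨ k = g := fun k hk => by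
    by_contra h
    push Not at h
    rcases hp.two e f g k hf hg hk hfg h.2.symm h.1.symm with h' | h' | h'
    · exact hn _ _ hf hg hfg h'
    · exact hn _ _ hg hk h.2.symm h'
    · exact hn _ _ hf hk h.1.symm h'
  have h₃ : ¬ (S.To e f ↔ S.To e g) := fun h => by
    obtain ⟨k, hk, h₄, h₅⟩ := H e f g hf hg hfg (hn _ _ hf hg hfg) h
    exact (h₂ k hk).elim h₄ h₅
  have h₄ : ¬ (S.To (p e) (p f) ↔ S.To (p e) (p g)) := fun h => by
    obtain ⟨k, hk, h₄, h₅⟩ := H (p e) (p f) (p g) ((hp.pA _ _).2 hf) ((hp.pA _ _).2 hg)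
      (fun h => hfg (hp.inj h)) (by rw [hp.pA]; exact hn _ _ hf hg hfg) h
    rw [hp.A_p_left] at hk
    rcases h₂ _ hk with h | h
    · exact h₄ (by rw [← h, hp.pp])
    · exact h₅ (by rw [← h, hp.pp])
  unfold Flips at *
  rw [← ((hp.pA _ _).2 hf).not_To_iff] at hef
  rw [← ((hp.pA _ _).2 hg).not_To_iff]
  tauto

theorem all_flips (H : ∀ m m₁ m₂, S.A m m₁ → S.A m m₂ → m₁ ≠ m₂ → ¬ S.A m₁ (p m₂) →
      (S.To m m₁ ↔ S.To m m₂) → ∃ m₃, S.A m m₃ ∧ m₃ ≠ m₁ ∧ m₃ ≠ m₂) (hC : Unsplit S.A)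
    {e f g : D} (hf : S.A e f) (hg : S.A e g) (hfg : f ≠ g) (h : S.A f (p g)) (x y : D)
    (hxy : S.A x y) : S.Flips p x y := by
  refine hC (fun x => ∀ y, S.A x y → S.Flips p x y) ?_ e x
    (fun y => flips_of_sides hp nf nb hf hg hfg h) y hxy
  intro a b hab h c hc
  exact flips_of_flips hp nf nb H hab.symm hc ((flips_comm hp hab).1 (h b hab))

theorem exists_comm_of_src (hF : ∀ x y, S.A x y → S.Flips p x y) {e f g : D}
    (hf : S.To e f) (hh : S.To g e) (hfh : S.A f (p g)) : ∃ x, p (S.r x) = S.r (p x) := by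
  have key : ∀ (S : DartSystem D V) (hp : IsDeck S.A p),
      (∀ x y, S.A x y → S.Flips p x y) → ∀ e f, S.To e f → S.s (p f) = S.s e →
      S.s (p e) = S.t (p f) → S.t (p e) = S.t f → ∃ x, p (S.r x) = S.r (p x) := by
    intro S hp hF e f hf a₂ a₃ a₄
    -- Both `p (r (p f))` and `r f` follow `p e`, and they are not distinct, since otherwise `r (p
    -- f)` would be adjacent to `p f`.
    refine ⟨p f, ?_⟩
    have e₁ : p e ≠ f := fun h => hp.pn e (h ▸ .inl hf)
    have e₃ := S.ext (p e) f
    have hk : S.To (S.r (p f)) e := by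
      simp only [A, To, S.s_r, S.t_r] at *
      grind
    have hrf : S.To (p e) (S.r f) := by
      simp only [A, To, S.s_r, S.t_r] at *
      grind
    have h₁ := (hF _ _ (.inl hk)).1 hk
    rw [hp.pp]
    by_contra hne
    have := A_r_of_To_To h₁ hrf hne
    rw [r_r, hp.A_p_left] at this
    exact not_A_r _ this.symm
  rcases mix_cases' hp nf nb hf hh hfh with ⟨a₁, a₂, a₃, a₄⟩ | ⟨a₁, a₂, a₃, a₄⟩
  · exact key S.op hp.op (fun x y h => (flips_op hp (by rwa [op_A] at h)).2
      (hF x y (by rwa [op_A] at h))) e g (op_To.2 hh) a₁ a₄ a₃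
  · exact key S hp hF e f hf a₂ a₃ a₄

end generic

theorem exists_mix_of_side (hp : IsDeck S.A p) (nf : ∀ e, p e ≠ S.r e) {e f g : D}
    (hf : S.A e f) (hg : S.A e g) (hfg : f ≠ g) (h : S.A f (p g)) :
    ∃ e f g, S.To e f ∧ S.To g e ∧ S.A f (p g) := by
  have key : ∀ (S : DartSystem D V), IsDeck S.A p → (∀ e, p e ≠ S.r e) → S.To e f → S.To e g →
      S.A f (p g) → S.To f (p g) := by
    intro S hp nf hf hg h
    have := src_D hp nf hf hg hfg h
    simp only [A, To] at *
    grind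
  have h' := hp.swap (fun _ _ => A.symm) h
  rcases hf with hf | hf <;> rcases hg with hg | hg
  · exact ⟨f, p g, e, key S hp nf hf hg h, hf, by rw [hp.pA]; exact .inr hg⟩
  · exact ⟨e, f, g, hf, hg, h⟩
  · exact ⟨e, g, f, hg, hf, h'⟩
  · refine ⟨f, e, p g, hf, ?_, by rw [hp.pp]; exact .inr hg⟩
    exact op_To.1 (key S.op hp.op nf (op_To.2 hf) (op_To.2 hg) (by rwa [op_A]))

theorem comm_of_flips (hp : IsDeck S.A p) (hC : Unsplit S.A)
    (hF : ∀ x y, S.A x y → S.Flips p x y) {e : D} (he : p (S.r e) = S.r (p e)) (f : D) :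
    p (S.r f) = S.r (p f) := by
  have key : ∀ (S : DartSystem D V), IsDeck S.A p → (∀ x y, S.A x y → S.Flips p x y) →
      ∀ e f, S.To e f → p (S.r e) = S.r (p e) → p (S.r f) = S.r (p f) := by
    intro S hp hF e f hf he
    have h₁ := (hF _ _ (.inl hf)).1 hf
    have h₂ := (hF _ _ (.inl (To_r.2 hf))).1 (To_r.2 hf)
    rw [he] at h₂
    by_contra hne
    have := A_r_of_To_To h₂ (To_r.2 h₁) hne
    rw [r_r, hp.pA] at this
    exact not_A_r _ this.symm
  refine hC (fun e => p (S.r e) = S.r (p e)) ?_ e f he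
  rintro e f (hf | hf) he
  · exact key S hp hF e f hf he
  · exact key S.op hp.op (fun x y h => (flips_op hp (by rwa [op_A] at h)).2
      (hF x y (by rwa [op_A] at h))) e f (op_To.2 hf) he

end DartSystem
end SimpleGraph

/-! ### The case without hexagons -/

namespace SimpleGraph
open DartSystem
namespace DartSystem

variable {D V W : Type*} {S : DartSystem D V} {T : DartSystem D W} {p : D → D}

theorem eqvGen_of_unsplit {R A : D → D → Prop} (h : Unsplit A) (hA : ∀ e f, A e f → R e f ∨ R f e)
    (x y : D) : Relation.EqvGen R x y :=
  h (fun y => Relation.EqvGen R x y) (fun e f hef he => he.trans _ _ _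
    ((hA e f hef).elim (.rel _ _) fun h => .symm _ _ (.rel _ _ h))) x y (.refl x)

/-- Otherwise every dart has at most one successor in `T`, and then no chain joins `e₀` to its
reversal, although `A` is connected. -/
theorem exists_side (hA : ∀ e f, S.A e f ↔ T.A e f) (hC : Unsplit S.A) (e₀ : D) :
    ∃ e f g, S.A e f ∧ S.A e g ∧ f ≠ g ∧ S.A f (T.r g) := by
  by_contra hn
  push Not at hn
  refine not_eqvGen_of_functional (R := T.To) (r := T.r) (fun x y z hy hz => ?_) T.r_r
    (fun x y => T.To_r.2) T.r_ne (fun x h => T.not_A_r x (.inl h)) e₀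
    (eqvGen_of_unsplit hC (fun e f h => (hA e f).1 h) _ _)
  by_contra hyz
  exact hn x y z ((hA _ _).2 (.inl hy)) ((hA _ _).2 (.inl hz)) hyz
    ((hA _ _).2 (T.A_r_of_To_To hy hz hyz))

/-- `A_p_r_of_mix` with the roles of the two systems exchanged. -/
theorem third_of_cross (hA : ∀ e f, S.A e f ↔ T.A e f) (nf : ∀ e, S.r e ≠ T.r e)
    (nb : ∀ e f g, ¬ T.Hex S.r e f g) {m m₁ m₂ : D} (h₁ : S.A m m₁) (h₂ : S.A m m₂)
    (hne : m₁ ≠ m₂) (hT : ¬ S.A m₁ (T.r m₂)) (hS : S.To m m₁ ↔ S.To m m₂) :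
    S.A m (T.r (S.r m₁)) ∨ S.A m (T.r (S.r m₂)) := by
  have hp : IsDeck T.A S.r := isDeck_of_A fun e f => (hA e f).symm
  have h₃ := (A_r_iff h₁ h₂ hne).2 hS
  have h₄ := (A_r_iff h₂ h₁ hne.symm).2 hS.symm
  rw [hA] at h₁ h₂ h₃ h₄ hT
  rw [T.A_r_iff h₁ h₂ hne] at hT
  simp only [hA]
  rcases h₁ with h₁ | h₁ <;> rcases h₂ with h₂ | h₂
  · exact absurd (iff_of_true h₁ h₂) hT
  · exact A_p_r_of_mix hp nf nb h₁ h₂ h₃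
  · exact (A_p_r_of_mix hp nf nb h₂ h₁ h₄).symm
  · exact absurd (iff_of_false h₁.asymm h₂.asymm) hT

theorem exists_third (hA : ∀ e f, S.A e f ↔ T.A e f) (nf : ∀ e, S.r e ≠ T.r e)
    (nb : ∀ e f g, ¬ T.Hex S.r e f g) (m m₁ m₂ : D) (h₁ : S.A m m₁) (h₂ : S.A m m₂)
    (hne : m₁ ≠ m₂) (hT : ¬ S.A m₁ (T.r m₂)) (hS : S.To m m₁ ↔ S.To m m₂) :
    ∃ m₃, S.A m m₃ ∧ m₃ ≠ m₁ ∧ m₃ ≠ m₂ := by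
  have h₃ := (A_r_iff h₁ h₂ hne).2 hS
  have h₄ := (A_r_iff h₂ h₁ hne.symm).2 hS.symm
  have key : ∀ a b, S.A b (S.r a) → T.r (S.r a) ≠ b := fun a b h h' => by
    rw [← h', hA] at h
    exact T.not_A_r _ h.symm
  rcases third_of_cross hA nf nb h₁ h₂ hne hT hS with h | h
  · exact ⟨_, h, fun h' => nf m₁ (T.r_eq_iff.1 h'), key _ _ h₄⟩
  · exact ⟨_, h, key _ _ h₃, fun h' => nf m₂ (T.r_eq_iff.1 h')⟩

theorem graph_iso_of_no_hex (hs : S.s.Surjective) (ht : T.s.Surjective)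
    (hA : ∀ e f, S.A e f ↔ T.A e f) (hC : Unsplit S.A) (nf : ∀ e, T.r e ≠ S.r e)
    (nb : ∀ e f g, ¬ S.Hex T.r e f g) (nb' : ∀ e f g, ¬ T.Hex S.r e f g) (e₀ : D) :
    Nonempty (S.graph ≃g T.graph) := by
  have hp := isDeck_of_A hA
  have nf' : ∀ e, S.r e ≠ T.r e := fun e => (nf e).symm
  obtain ⟨e₁, f₁, g₁, he₁, he₂, hne₁, hside₁⟩ := exists_side hA hC e₀
  have hF : ∀ x y, S.A x y → S.Flips T.r x y :=
    all_flips hp nf nb (exists_third hA nf' nb') hC he₁ he₂ hne₁ hside₁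
  have hcomm : ∀ e, T.r (S.r e) = S.r (T.r e) := by
    obtain ⟨e, f, g, h₁, h₂, h₃⟩ := exists_mix_of_side hp nf he₁ he₂ hne₁ hside₁
    obtain ⟨x, hx⟩ := exists_comm_of_src hp nf nb hF h₁ h₂ h₃
    exact comm_of_flips hp hC hF hx
  -- the induced involution on vertices
  have hwell : ∀ e f, S.s e = S.s f → S.t (T.r e) = S.t (T.r f) := fun e f h => by
    rcases S.s_eq_iff.1 h with rfl | h
    · rfl
    · have := ((hF _ _ (.inl h)).1 h).1
      rw [this, hcomm, S.s_r]
  obtain ⟨σ, hσ⟩ : ∃ σ : V → V, ∀ e, σ (S.s e) = S.t (T.r e) := by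
    choose i hi using hs
    exact ⟨fun v => S.t (T.r (i v)), fun e => hwell _ _ (hi _)⟩
  have hσt : ∀ e, σ (S.t e) = S.s (T.r e) := fun e => by
    rw [← S.s_r, hσ, hcomm, S.t_r]
  have hσσ : ∀ v, σ (σ v) = v := fun v => by
    obtain ⟨e, rfl⟩ := hs v
    rw [hσ, hσt, T.r_r]
  have hσs : ∀ e, σ (S.s e) ≠ S.s e := fun e h => by
    rw [hσ] at h
    have h₁ := hp.pn e
    have h₂ := S.ext (T.r e) (S.r e)
    have h₃ := nf e
    simp only [A, To, S.s_r, S.t_r] at *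
    grind
  have hσne : ∀ e, σ (S.s e) ≠ S.t e := fun e h => by
    have h₁ : S.s (T.r e) = S.s e := by rw [← hσt, ← h, hσσ]
    have h₂ : S.t (T.r e) = S.t e := by rw [← hσ, h]
    exact hp.ne e (S.ext _ _ h₁ h₂)
  let Q : D → D := fun e => S.r (T.r e)
  have hQs : ∀ e, S.s (Q e) = σ (S.s e) := fun e => by rw [S.s_r, hσ]
  have hQt : ∀ e, S.t (Q e) = σ (S.t e) := fun e => by rw [S.t_r, hσt]
  -- Darts are identified when their endpoints agree up to `σ`; `R` is nonbacktracking succession,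
  -- with backtracking also understood up to `σ`.
  let E : Setoid D :=
    { r := fun e f => (S.s e = S.s f ∨ S.s e = σ (S.s f)) ∧ (S.t e = S.t f ∨ S.t e = σ (S.t f))
      iseqv := ⟨fun e => ⟨.inl rfl, .inl rfl⟩, by grind, by grind⟩ }
  let R : D → D → Prop := fun e f => S.t e = S.s f ∧ S.t f ≠ S.s e ∧ S.t f ≠ σ (S.s e)
  have hRA : ∀ e f, R e f → S.To e f ∧ ¬ S.A e (T.r (S.r f)) := fun e f ⟨h₁, h₂, h₃⟩ => by
    refine ⟨⟨h₁, h₂.symm⟩, ?_⟩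
    have q₁ := hQs f
    have q₂ := hQt f
    have q₃ := hσs f
    simp only [Q, ← hcomm] at q₁ q₂
    have := hσσ (S.t f)
    simp only [A, To]
    grind
  -- Two successors of `e` on the same `p`-side end at points exchanged by `σ`. On different
  -- `p`-sides, `third_of_cross` makes the `p ∘ S.r`-image of one of them adjacent to `e`, which `R`
  -- forbids.
  have hfun₀ : ∀ e f g, R e f → R e g → E f g := fun e f g hf hg => by
    refine ⟨.inl (hf.1.symm.trans hg.1), ?_⟩
    by_cases hfg : f = g
    · exact .inl (by rw [hfg])
    obtain ⟨hf, hf'⟩ := hRA _ _ hf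
    obtain ⟨hg, hg'⟩ := hRA _ _ hg
    by_cases h : S.A f (T.r g)
    · have := (src_D hp nf hf hg hfg h).2.1
      rw [← hσt] at this
      exact .inr this.symm
    · exact ((third_of_cross hA nf' nb' (.inl hf) (.inl hg) hfg h (iff_of_true hf hg)).elim
        hf' hg').elim
  have hRQ : ∀ e f, R e f → R (Q e) (Q f) := fun e f h => by
    have := hσσ (S.t f)
    have := hσσ (S.s e)
    simp only [R, hQs, hQt] at *
    grind
  have hEQ : ∀ e f, E (Q e) f ↔ E e f := fun e f => by
    change (_ ∧ _) ↔ (_ ∧ _)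
    rw [hQs, hQt]
    have := hσσ (S.s e)
    have := hσσ (S.t e)
    have := hσσ (S.s f)
    have := hσσ (S.t f)
    grind
  have hfun : ∀ e e' f g, R e f → R e' g → E e e' → E f g := fun e e' f g hf hg hee => by
    have key : ∀ e' g, R e' g → E e e' → S.t e = S.t e' → E f g := fun e' g hg hee h => by
      refine hfun₀ e f g hf ?_
      have h₁ : (S.s e = S.s e' ∨ S.s e = σ (S.s e')) := hee.1
      have := hσσ (S.s e')
      simp only [R] at *
      grind
    rcases hee.2 with h | h
    · exact key e' g hg hee h
    · exact E.trans (key (Q e') (Q g) (hRQ _ _ hg) (E.trans hee (E.symm ((hEQ _ _).2 (E.refl _))))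
        (h.trans (hQt _).symm)) ((hEQ _ _).2 (E.refl _))
  have hchain := not_eqvGen_of_functional_mod (R := R) (r := S.r) E hfun r_r
    (fun x y h => by
      have := hσσ (S.t y)
      simp only [R, S.s_r, S.t_r] at *
      grind)
    (fun x y h => by
      change (_ ∧ _)
      rw [S.s_r, S.t_r, S.s_r, S.t_r]
      exact h.symm)
    (fun x h => by
      have h' : (_ ∨ _) ∧ _ := h
      rw [S.s_r] at h'
      have := hσne x
      have := S.s_ne_t x
      grind)
    (fun x y h h' => by
      have h' : _ ∧ (_ ∨ _) := h'
      rw [S.t_r] at h'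
      simp only [R] at h
      grind) e₀
  set I : D → Prop := Relation.EqvGen (fun x y => R x y ∨ E x y) e₀ with hI
  have hIQ : ∀ e, I (Q e) ↔ I e := fun e => by
    have h : E (Q e) e := (hEQ e e).2 (E.refl e)
    exact ⟨fun h' => h'.trans _ _ _ (.rel _ _ (.inr h)),
      fun h' => h'.trans _ _ _ (.rel _ _ (.inr (E.symm h)))⟩
  have hQQ : ∀ e, Q (Q e) = e := fun e => by
    simp only [Q]; rw [hcomm, T.r_r, r_r]
  have hQA : ∀ e f, S.A (Q e) (Q f) ↔ S.A e f := fun e f => A_r.trans (hp.pA _ _)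
  -- An adjacency leaving the class `I` is not a step of `R`, so it backtracks up to `σ`, and
  -- applying `σ` to `u` leaves it adjacent to `i`.
  have hcross : ∀ i u, I i → ¬ I u → S.A i u → S.A i (Q u) := fun i u hi hu h => by
    have h₁ : ¬ R i u := fun h => hu (hi.trans _ _ _ (.rel _ _ (.inl h)))
    have h₂ : ¬ R u i := fun h => hu (hi.trans _ _ _ (.symm _ _ (.rel _ _ (.inl h))))
    have h₃ := hσs u
    have h₄ := hσs (S.r u)
    have h₅ := hσσ (S.s i)
    have h₆ := hσσ (S.t i)
    have h₇ := hσs i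
    have h₈ := hσs (S.r i)
    have h₉ := hσσ (S.s u)
    rw [S.s_r] at h₄ h₈
    simp only [R, A, To, hQs, hQt] at *
    grind
  obtain ⟨θ, hθ, hθ₁, hθ₂⟩ := exists_partial_perm (A := S.A) (fun _ _ => A.symm) I
    ⟨Q, Q, hQQ, hQQ⟩ hQA hIQ (fun i u hi hu => by
      refine ⟨hcross i u hi hu, fun h => ?_⟩
      have := hcross i (Q u) hi (by rwa [hIQ]) h
      rwa [hQQ] at this)
  rw [← T.comap_graph θ]
  -- `e₀` is in `I` and `r e₀` is not, so after the twist both systems reverse `e₀` alike.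
  refine graph_iso_of_common_reversal hs (ht.comp θ.surjective)
    (fun e f => by rw [comap_A, ← hA, hθ]) hC (e₀ := e₀) ?_
  have h₁ : I e₀ := .refl _
  have h₂ : ¬ I (S.r e₀) := hchain
  simp only [comap, Equiv.symm_apply_eq]
  rw [hθ₁ _ h₁, hθ₂ _ h₂]
  simp only [Equiv.coe_fn_mk, Q]
  rw [hcomm, r_r]

end DartSystem
end SimpleGraph

/-! ### The neighbourhood of a hexagon -/

namespace SimpleGraph
open DartSystem
namespace DartSystem

variable {D V W : Type*} {S : DartSystem D V} {T : DartSystem D W} {p : D → D} {e f g : D}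

theorem Hex.rot (hp : IsDeck S.A p) (h : S.Hex p e f g) : S.Hex p f g (p e) := by
  simp only [Hex, hp.pp] at *
  tauto

theorem Hex.rot_rot (hp : IsDeck S.A p) (h : S.Hex p e f g) : S.Hex p g (p e) (p f) :=
  (h.rot hp).rot hp

theorem Hex.half (hp : IsDeck S.A p) (h : S.Hex p e f g) : S.Hex p (p e) (p f) (p g) :=
  (h.rot_rot hp).rot hp

theorem Hex.rot_neg (hp : IsDeck S.A p) (h : S.Hex p e f g) : S.Hex p (p g) e f := by
  have := (h.half hp).rot_rot hp
  rwa [hp.pp, hp.pp] at this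

theorem Hex.t_eq (h : S.Hex p e f g) : S.t e = S.s f ∧ S.t f = S.s g ∧ S.t g = S.s (p e) ∧
    S.t (p e) = S.s (p f) ∧ S.t (p f) = S.s (p g) ∧ S.t (p g) = S.s e :=
  ⟨h.1.1, h.2.1.1, h.2.2.1.1, h.2.2.2.1.1, h.2.2.2.2.1.1, h.2.2.2.2.2.1⟩

theorem Hex.nodup (hp : IsDeck S.A p) (h : S.Hex p e f g) :
    [S.s e, S.s f, S.s g, S.s (p e), S.s (p f), S.s (p g)].Nodup := by
  have key : ∀ {e f g}, S.Hex p e f g →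
      S.s e ≠ S.s f ∧ S.s e ≠ S.s g ∧ S.s e ≠ S.s (p e) := by
    intro e f g h
    obtain ⟨h₁, h₂, h₃, h₄, h₅, h₆⟩ := h
    have n₁ := S.s_ne_t e
    have n₃ := S.s_ne_t f
    have n₂ := hp.pc g e
    simp only [A, To] at *
    grind
  have h₁ := key h
  have h₂ := key (h.rot hp)
  have h₃ := key (h.rot_rot hp)
  have h₄ := key (h.half hp)
  have h₅ := key ((h.half hp).rot hp)
  have h₆ := key (h.rot_neg hp)
  simp only [hp.pp] at *
  simp only [List.nodup_cons, List.mem_cons, List.not_mem_nil, or_false, not_or, not_false_eq_true,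
    List.nodup_nil, and_true]
  grind

/-- `x` leaves the walk `e, f` at the middle vertex. -/
def Spoke (S : DartSystem D V) (e f x : D) : Prop := S.To e x ∧ x ≠ f

section

variable (hp : IsDeck S.A p) (nf : ∀ e, p e ≠ S.r e) (h : S.Hex p e f g)
include hp nf h

/-- A diagonal would be on the `p`-side of `f`, and `src_D` would then identify two vertices of the
hexagon. -/
theorem Hex.no_chord {x : D} (hx : S.Spoke e f x) : S.t x ≠ S.s (p f) := by
  intro hc
  have hn := h.nodup hp
  have ht := h.t_eq
  obtain ⟨hx, hxf⟩ := hx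
  simp only [List.nodup_cons, List.mem_cons, List.not_mem_nil, or_false, not_or] at hn
  have h₁ : S.A f (p x) := by
    rw [← hp.A_p_left]
    simp only [A, To] at *
    grind
  have := src_D hp nf h.1 hx hxf.symm h₁
  grind

theorem Hex.spoke_end {x : D} (hx : S.Spoke e f x) :
    S.t x ∉ [S.s e, S.s f, S.s g, S.s (p e), S.s (p f), S.s (p g)] := by
  have hc := h.no_chord hp nf hx
  have hn := h.nodup hp
  have ht := h.t_eq
  obtain ⟨hx, hxf⟩ := hx
  have n₁ := S.s_ne_t x
  have n₂ := S.ext x f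
  have n₃ := hp.pc x e
  have n₄ := hp.pc (S.r x) f
  simp only [List.nodup_cons, List.mem_cons, List.not_mem_nil, or_false, not_or] at *
  simp only [A, To, S.s_r, S.t_r] at *
  grind

theorem Hex.not_side {x : D} (hx : S.Spoke e f x) : ¬ S.A f (p x) := by
  rw [← hp.A_p_left]
  have hc := h.no_chord hp nf hx
  have hn := h.nodup hp
  have ht := h.t_eq
  obtain ⟨hx, hxf⟩ := hx
  simp only [List.nodup_cons, List.mem_cons, List.not_mem_nil, or_false, not_or] at *
  simp only [A, To] at *
  grind

/-- Two spokes are both off the `p`-side of `f`, so they share one. Around `x` this puts `e` and `r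
f` on the same `p`-side, making `p e` adjacent to `r f`, which the hexagon excludes. Hence its
vertices have degree at most three. -/
theorem Hex.spoke_unique {x x' : D} (hx : S.Spoke e f x) (hx' : S.Spoke e f x') : x = x' := by
  by_contra hne
  have hs : ∀ e f, S.A e f → S.A f e := fun _ _ => A.symm
  have h₁ : S.A x (p x') := by
    rcases hp.two e f x x' (.inl h.1) (.inl hx.1) (.inl hx'.1) hx.2.symm hne hx'.2.symm
      with h' | h' | h'
    · exact absurd h' (h.not_side hp nf hx)
    · exact h'
    · exact absurd h' (h.not_side hp nf hx')
  have hd := src_D hp nf hx.1 hx'.1 hne h₁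
  have hn := h.nodup hp
  have ht := h.t_eq
  have n₀ := S.ext x f
  have n₁ := S.ext x' f
  have hfx : S.To (S.r f) x := by
    obtain ⟨⟨a, b⟩, c⟩ := hx
    simp only [To, S.s_r, S.t_r] at *
    grind
  have hfx' : S.To (S.r f) x' := by
    obtain ⟨⟨a, b⟩, c⟩ := hx'
    simp only [To, S.s_r, S.t_r] at *
    grind
  have h₂ : S.A (S.r f) (p (p x')) := by rw [hp.pp]; exact .inl hfx'
  have h₃ : S.A e (p (p x')) := by rw [hp.pp]; exact .inl hx'.1
  have h₄ : e ≠ S.r f := fun h' => not_A_r f (.inr (h' ▸ h.1))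
  have h₅ := hp.trans x e (p x') (S.r f) (.inr hx.1) h₁ (.inr hfx) h₄ h₃ (hp.swap hs h₂)
  rw [← hp.A_p_left] at h₅
  simp only [List.nodup_cons, List.mem_cons, List.not_mem_nil, or_false, not_or] at *
  simp only [A, To, S.s_r, S.t_r] at *
  grind

/-- Spokes at both ends of `e` lie off the `p`-side of `f`, hence on a common one; among the
positions in `mix_hex_or` only a second hexagon through `e` is possible. -/
theorem Hex.of_spokes {x z : D} (hx : S.Spoke e f x) (hz : S.Spoke (p g) e z) :
    S.Hex p e x (p (S.r z)) := by
  have hn := h.nodup hp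
  have ht := h.t_eq
  have c₁ := h.no_chord hp nf hx
  have c₂ := (h.rot_neg hp).no_chord hp nf hz
  obtain ⟨hz, hze⟩ := hz
  simp only [List.nodup_cons, List.mem_cons, List.not_mem_nil, or_false, not_or] at *
  have n₀ := S.ext z e
  have hy : S.To (S.r z) e := by
    simp only [To, S.s_r, S.t_r] at *
    grind
  have hne : x ≠ S.r z := fun h => hy.asymm (h ▸ hx.1)
  have hne' : f ≠ S.r z := fun h' => hy.asymm (h' ▸ h.1)
  have hside : S.A x (p (S.r z)) := by
    rcases hp.two e f x (S.r z) (.inl h.1) (.inl hx.1) (.inr hy) hx.2.symm hne hne'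
      with h' | h' | h'
    · exact absurd h' (h.not_side hp nf hx)
    · exact h'
    · rw [← hp.A_p_left] at h'
      simp only [A, To, S.s_r, S.t_r] at *
      grind
  rcases mix_hex_or hp nf hx.1 hy hside with h' | h' | h'
  · exact h'
  · simp only [S.s_r] at *
    grind
  · grind

omit hp nf h in
theorem Hex.spoke_or (h : S.Hex p e f g) {y : D} (hy : S.A e y) (hf : y ≠ f) (hg : y ≠ p g) :
    S.Spoke e f y ∨ S.Spoke (p g) e (S.r y) := by
  have ht := h.t_eq
  rcases hy with hy | hy
  · exact .inl ⟨hy, hf⟩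
  · refine .inr ⟨?_, fun h' => not_A_r y (.inl (h' ▸ hy))⟩
    have := S.ext y (p g)
    simp only [To, S.s_r, S.t_r] at *
    grind

omit nf h in
theorem Hex.spoke_or_half (h : S.Hex p e f g) {y : D} (hy : S.A e y) (hf : y ≠ f)
    (hg : y ≠ p g) : S.Spoke (p e) (p f) (p y) ∨ S.Spoke g (p e) (S.r (p y)) := by
  have := (h.half hp).spoke_or (y := p y) ((hp.pA _ _).2 hy) (fun h => hf (hp.inj h))
    (fun h => hg (hp.inj h))
  rwa [hp.pp] at this

omit hp nf in
theorem Hex.adj_iff (w : V) : S.graph.Adj (S.s f) w ↔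
    w = S.s e ∨ w = S.s g ∨ ∃ x, S.Spoke e f x ∧ w = S.t x := by
  have ht := h.t_eq
  constructor
  · rintro ⟨x, hx, rfl⟩
    by_cases h₁ : S.t x = S.s e
    · exact .inl h₁
    by_cases h₂ : x = f
    · exact .inr (.inl (h₂ ▸ ht.2.1))
    · exact .inr (.inr ⟨x, ⟨⟨ht.1.trans hx.symm, fun h => h₁ h.symm⟩, h₂⟩, rfl⟩)
  · rintro (rfl | rfl | ⟨x, hx, rfl⟩)
    · exact ⟨S.r e, by rw [S.s_r, ht.1], S.t_r e⟩
    · exact ⟨f, rfl, ht.2.1⟩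
    · exact ⟨x, by rw [← hx.1.1, ht.1], rfl⟩

theorem Hex.adj_iff_of_spoke {x : D} (hx : S.Spoke e f x) (w : V) :
    S.graph.Adj (S.s f) w ↔ w = S.s e ∨ w = S.s g ∨ w = S.t x := by
  rw [h.adj_iff]
  refine or_congr_right (or_congr_right ⟨?_, fun h => ⟨x, hx, h⟩⟩)
  rintro ⟨y, hy, rfl⟩
  rw [h.spoke_unique hp nf hy hx]

omit hp nf in
theorem Hex.adj_iff_of_no_spoke (hn : ¬ ∃ x, S.Spoke e f x) (w : V) :
    S.graph.Adj (S.s f) w ↔ w = S.s e ∨ w = S.s g := by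
  rw [h.adj_iff]
  refine or_congr_right (or_iff_left ?_)
  rintro ⟨x, hx, _⟩
  exact hn ⟨x, hx⟩

end

end DartSystem
end SimpleGraph

/-! ### Explicit charts and isolated spokes -/

namespace SimpleGraph
open DartSystem
namespace DartSystem

variable {D V W : Type*} {S : DartSystem D V} {T : DartSystem D W} {p : D → D} {e f g : D}

/-- The underlying graph has vertices labelled by `Fin n`, with neighbours listed by `nb`. -/
def Charted (S : DartSystem D V) {n : ℕ} (nb : Fin n → List (Fin n)) : Prop :=
  ∃ v : Fin n → V, v.Injective ∧ v.Surjective ∧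
    ∀ i w, S.graph.Adj (v i) w ↔ ∃ j ∈ nb i, w = v j

/-- The labelled vertices are closed under adjacency, so connectedness makes the labelling
surjective. -/
theorem charted_of_nodup (hs : S.s.Surjective) (hS : S.Conn) {n : ℕ}
    {nb : Fin (n + 1) → List (Fin (n + 1))} (v : Fin (n + 1) → V) (hv : (List.ofFn v).Nodup)
    (h : ∀ i w, S.graph.Adj (v i) w ↔ ∃ j ∈ nb i, w = v j) : S.Charted nb := by
  refine ⟨v, List.nodup_ofFn.1 hv, fun w => ?_, h⟩
  have hcl : ∀ e, S.s e ∈ Set.range v ↔ S.t e ∈ Set.range v := fun e => by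
    constructor
    · rintro ⟨i, hi⟩
      obtain ⟨j, -, hj⟩ := (h i (S.t e)).1 ⟨e, hi.symm, rfl⟩
      exact ⟨j, hj.symm⟩
    · rintro ⟨i, hi⟩
      obtain ⟨j, -, hj⟩ := (h i (S.s e)).1 ⟨S.r e, by rw [S.s_r, hi], S.t_r e⟩
      exact ⟨j, hj.symm⟩
  obtain ⟨e, rfl⟩ := hs w
  obtain ⟨e₀, he₀⟩ := hs (v 0)
  refine hS (fun e => S.s e ∈ Set.range v) ?_ e₀ e ⟨0, he₀.symm⟩
  rintro e f ((hf | hf) | rfl) he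
  · rwa [← hf.1, ← hcl]
  · rwa [hcl, hf.1]
  · rwa [S.s_r, ← hcl]

theorem Charted.iso {n : ℕ} {nb : Fin n → List (Fin n)} (hS : S.Charted nb)
    (hT : T.Charted nb) : Nonempty (S.graph ≃g T.graph) := by
  obtain ⟨v, hi, hs, h⟩ := hS
  obtain ⟨v', hi', hs', h'⟩ := hT
  have key : ∀ i j, T.graph.Adj (v' i) (v' j) ↔ S.graph.Adj (v i) (v j) := fun i j => by
    rw [h, h']
    simp only [hi.eq_iff, hi'.eq_iff]
  refine ⟨⟨(Equiv.ofBijective v ⟨hi, hs⟩).symm.trans (Equiv.ofBijective v' ⟨hi', hs'⟩), ?_⟩⟩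
  intro a b
  obtain ⟨i, rfl⟩ := hs a
  obtain ⟨j, rfl⟩ := hs b
  have hE : ∀ i, (Equiv.ofBijective v ⟨hi, hs⟩).symm (v i) = i :=
    (Equiv.ofBijective v ⟨hi, hs⟩).symm_apply_apply
  change T.graph.Adj (v' _) (v' _) ↔ _
  rw [hE, hE, key]

/-- The hexagon with two opposite pendant edges. -/
def pendantChart : Fin 8 → List (Fin 8) :=
  ![[5, 1], [0, 2, 6], [1, 3], [2, 4], [3, 5, 7], [4, 0], [1], [4]]

/-- The hexagon with two additional paths of length two. -/
def bridgedChart : Fin 8 → List (Fin 8) :=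
  ![[5, 1, 6], [0, 2, 7], [1, 3], [2, 4, 7], [3, 5, 6], [4, 0], [0, 4], [1, 3]]

/-- The cube. -/
def cubeChart : Fin 8 → List (Fin 8) :=
  ![[5, 1, 6], [0, 2, 7], [1, 3, 6], [2, 4, 7], [3, 5, 6], [4, 0, 7], [0, 4, 2], [1, 3, 5]]

/-- The complete graph on four vertices with all edges subdivided. -/
def tetraChart : Fin 10 → List (Fin 10) :=
  ![[5, 1, 6], [0, 2], [1, 3, 7], [2, 4], [3, 5, 8], [4, 0], [0, 9], [2, 9], [4, 9], [6, 7, 8]]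

section

variable (hp : IsDeck S.A p) (nf : ∀ e, p e ≠ S.r e) (h : S.Hex p e f g)
include hp nf h

omit hp nf in
theorem Hex.eq_or_of_A (n₁ : ¬ ∃ x, S.Spoke e f x) (n₀ : ¬ ∃ x, S.Spoke (p g) e x) {y : D}
    (hy : S.A e y) : y = f ∨ y = p g := by
  by_contra hne
  push Not at hne
  exact (h.spoke_or hy hne.1 hne.2).elim (fun h => n₁ ⟨_, h⟩) fun h => n₀ ⟨_, h⟩

-- Without spokes the six darts of the hexagon are closed under adjacency and contain no reversal of
-- `e`, against connectedness of `A`.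
omit nf in
theorem Hex.exists_spoke (hC : Unsplit S.A) : (∃ x, S.Spoke e f x) ∨ (∃ x, S.Spoke f g x) ∨
    (∃ x, S.Spoke g (p e) x) ∨ (∃ x, S.Spoke (p e) (p f) x) ∨ (∃ x, S.Spoke (p f) (p g) x) ∨
    (∃ x, S.Spoke (p g) e x) := by
  by_contra hn
  simp only [not_or] at hn
  obtain ⟨n₁, n₂, n₃, n₄, n₅, n₀⟩ := hn
  have k₀ := fun y => h.eq_or_of_A n₁ n₀ (y := y)
  have k₁ := fun y => (h.rot hp).eq_or_of_A n₂ (by rwa [hp.pp]) (y := y)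
  have k₂ := fun y => (h.rot_rot hp).eq_or_of_A n₃ (by rwa [hp.pp]) (y := y)
  have k₃ := fun y => (h.half hp).eq_or_of_A n₄ (by rwa [hp.pp]) (y := y)
  have k₄ := fun y => ((h.half hp).rot hp).eq_or_of_A n₅ (by rwa [hp.pp]) (y := y)
  have k₅ := fun y => (h.rot_neg hp).eq_or_of_A n₀ n₅ (y := y)
  simp only [hp.pp] at k₀ k₁ k₂ k₃ k₄ k₅
  have := hC (fun x => x = e ∨ x = f ∨ x = g ∨ x = p e ∨ x = p f ∨ x = p g) (by
    rintro a b hab (rfl | rfl | rfl | rfl | rfl | rfl)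
    · have := k₀ _ hab; tauto
    · have := k₁ _ hab; tauto
    · have := k₂ _ hab; tauto
    · have := k₃ _ hab; tauto
    · have := k₄ _ hab; tauto
    · have := k₅ _ hab; tauto) e (S.r e) (.inl rfl)
  have hn := h.nodup hp
  have ht := h.t_eq
  have r₁ := S.s_r e
  have r₂ := S.t_r e
  simp only [List.nodup_cons, List.mem_cons, List.not_mem_nil, or_false, not_or] at hn
  grind

/-- A spoke whose neighbours have none ends in a leaf. -/
theorem Hex.adj_end_iff (n₀ : ¬ ∃ x, S.Spoke (p g) e x) (n₂ : ¬ ∃ x, S.Spoke f g x)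
    (n₃ : ¬ ∃ x, S.Spoke g (p e) x) {x : D} (hx : S.Spoke e f x) (w : V) :
    S.graph.Adj (S.t x) w ↔ w = S.s f := by
  have hn := h.nodup hp
  have ht := h.t_eq
  have hxe := h.spoke_end hp nf hx
  have hpx := (h.spoke_or_half hp (.inl hx.1) hx.2 (fun h' => hx.1.asymm
    (h' ▸ h.2.2.2.2.2))).resolve_right fun h => n₃ ⟨_, h⟩
  have hpxe := (h.half hp).spoke_end hp nf hpx
  have hN : ∀ y, S.A e y → y = f ∨ y = p g ∨ y = x := fun y hy => by
    by_contra hne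
    push Not at hne
    rcases h.spoke_or hy hne.1 hne.2.1 with h' | h'
    · exact hne.2.2 (h.spoke_unique hp nf h' hx)
    · exact n₀ ⟨_, h'⟩
  have hs : ∀ e f, S.A e f → S.A f e := fun _ _ => A.symm
  have hsx : S.s x = S.s f := hx.1.1.symm.trans ht.1
  constructor
  · rintro ⟨k, hk, rfl⟩
    by_contra hne
    have hxk : S.To x k := ⟨hk.symm, fun h => hne (h.symm.trans hsx)⟩
    have hrf : S.To (S.r f) x := by
      have := S.ext x f
      obtain ⟨-, h₂⟩ := hx
      simp only [To, S.s_r, S.t_r] at *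
      grind
    simp only [List.nodup_cons, List.mem_cons, List.not_mem_nil, or_false, not_or, hp.pp] at *
    have c₁ : ¬ S.A e (p (S.r f)) := fun h' => by
      have r₁ := S.s_r f
      have r₂ := S.t_r f
      have hpxs := hpx.1.1
      rw [hp.A_p_left.symm] at h'
      have q₁ := hN (p (S.r f)) (by rwa [← hp.A_p_left])
      have q₂ : S.r f = p f ∨ S.r f = g ∨ S.r f = p x := by
        rcases q₁ with h | h | h
        · exact .inl (by rw [← hp.pp (S.r f), h])
        · exact .inr (.inl (hp.inj h))
        · exact .inr (.inr (by rw [← hp.pp (S.r f), h]))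
      grind
    have c₂ : ¬ S.A e (p k) := fun h' => by
      have hpxs := hpx.1.1
      have q₁ := hN _ h'
      have q₂ : k = p f ∨ k = g ∨ k = p x := by
        rcases q₁ with h | h | h
        · exact .inl (by rw [← hp.pp k, h])
        · exact .inr (.inl (hp.inj h))
        · exact .inr (.inr (by rw [← hp.pp k, h]))
      grind
    have c₃ : S.A k (p (S.r f)) := by
      have d₁ : e ≠ S.r f := fun h' => not_A_r f (.inr (h' ▸ h.1))
      have d₂ : e ≠ k := fun h' => hxk.asymm (h' ▸ hx.1)
      have d₃ : S.r f ≠ k := fun h' => hxk.asymm (h' ▸ hrf)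
      rcases hp.two x e (S.r f) k (.inr hx.1) (.inr hrf) (.inl hxk) d₁ d₃ d₂ with h' | h' | h'
      · exact absurd h' c₁
      · exact hp.swap hs h'
      · exact absurd h' c₂
    have hpxs := hpx.1.1
    have nsp : ∀ y, S.s y = S.s g → S.t y = S.s f ∨ S.t y = S.s (p e) := fun y hy => by
      have := ((h.rot hp).adj_iff_of_no_spoke n₂ (S.t y)).1 ⟨y, hy, rfl⟩
      exact this
    have nsp' := fun y hy => ((h.adj_iff_of_spoke hp nf hx (S.t y)).1 ⟨y, hy, rfl⟩)
    rcases mix_hex_or hp nf hxk hrf c₃ with h' | ⟨a₁, a₂, a₃, a₄⟩ | ⟨a₁, a₂, a₃, a₄⟩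
    · have b₁ := h'.2.2.2.1.1
      have b₂ := h'.2.2.2.2.1.1
      have b₃ := nsp (S.r (p k)) (by rw [S.s_r, b₂, hp.pp, S.s_r, ht.2.1])
      rw [S.t_r] at b₃
      grind
    · rw [S.s_r] at a₃
      grind
    · have := nsp' (p k) (a₂.trans hsx)
      grind
  · rintro rfl
    exact ⟨S.r x, S.s_r x, (S.t_r x).trans hsx⟩

end

end DartSystem
end SimpleGraph

/-! ### Hexagons with spokes in antipodal pairs -/

namespace SimpleGraph
open DartSystem
namespace DartSystem

variable {D V W : Type*} {S : DartSystem D V} {T : DartSystem D W} {p : D → D} {e f g : D}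

section

variable (hp : IsDeck S.A p) (nf : ∀ e, p e ≠ S.r e) (h : S.Hex p e f g)
include hp nf h

theorem Hex.pendantChart (hs : S.s.Surjective) (hS : S.Conn) (n₀ : ¬ ∃ x, S.Spoke (p g) e x)
    (n₂ : ¬ ∃ x, S.Spoke f g x) (n₃ : ¬ ∃ x, S.Spoke g (p e) x)
    (n₅ : ¬ ∃ x, S.Spoke (p f) (p g) x) {x : D} (hx : S.Spoke e f x) :
    S.Charted pendantChart := by
  have hpx := (h.spoke_or_half hp (.inl hx.1) hx.2 (fun h' => hx.1.asymm
    (h' ▸ h.2.2.2.2.2))).resolve_right fun h => n₃ ⟨_, h⟩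
  have c₀ := (h.rot_neg hp).adj_iff_of_no_spoke n₀
  have c₁ := h.adj_iff_of_spoke hp nf hx
  have c₂ := (h.rot hp).adj_iff_of_no_spoke n₂
  have c₃ := (h.rot_rot hp).adj_iff_of_no_spoke n₃
  have c₄ := (h.half hp).adj_iff_of_spoke hp nf hpx
  have c₅ := ((h.half hp).rot hp).adj_iff_of_no_spoke n₅
  have c₆ := h.adj_end_iff hp nf n₀ n₂ n₃ hx
  have c₇ := (h.half hp).adj_end_iff hp nf (by rwa [hp.pp]) n₅ (by rwa [hp.pp]) hpx
  have hn := h.nodup hp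
  have k₁ := h.spoke_end hp nf hx
  have k₄ := (h.half hp).spoke_end hp nf hpx
  have hne : S.t x ≠ S.t (p x) := fun h' => by
    have h₁ := (c₆ (S.s f)).2 rfl
    rw [h', c₇] at h₁
    simp only [List.nodup_cons, List.mem_cons, List.not_mem_nil, or_false, not_or] at hn
    grind
  simp only [hp.pp] at c₅ k₄
  refine charted_of_nodup hs hS
    ![S.s e, S.s f, S.s g, S.s (p e), S.s (p f), S.s (p g), S.t x, S.t (p x)] ?_ ?_
  · change [S.s e, S.s f, S.s g, S.s (p e), S.s (p f), S.s (p g), S.t x, S.t (p x)].Nodup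
    simp only [List.nodup_cons, List.mem_cons, List.not_mem_nil, or_false, not_or,
      not_false_eq_true, List.nodup_nil, and_true] at *
    grind
  · intro i w
    fin_cases i
    · refine (c₀ w).trans ?_; simp [DartSystem.pendantChart]
    · refine (c₁ w).trans ?_; simp [DartSystem.pendantChart]
    · refine (c₂ w).trans ?_; simp [DartSystem.pendantChart]
    · refine (c₃ w).trans ?_; simp [DartSystem.pendantChart]
    · refine (c₄ w).trans ?_; simp [DartSystem.pendantChart]
    · refine (c₅ w).trans ?_; simp [DartSystem.pendantChart]
    · refine (c₆ w).trans ?_; simp [DartSystem.pendantChart]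
    · refine (c₇ w).trans ?_; simp [DartSystem.pendantChart]

/-- Such a `k` permits `of_spokes` on the hexagon through `x`; the new hexagon shows that `r (p k)`
is a spoke at `s g`. -/
theorem Hex.no_third_spoke {x z : D} (hx : S.Spoke e f x) (hz : S.Spoke (p g) e z)
    (n₂ : ¬ ∃ x, S.Spoke f g x) : ¬ ∃ k, S.Spoke x (p (S.r z)) k := by
  rintro ⟨k, hk⟩
  have h₁ := h.of_spokes hp nf hx hz
  have h₂ := (h₁.rot hp).of_spokes hp nf (x := k) (z := f) hk
    (by rw [hp.pp]; exact ⟨h.1, hx.2.symm⟩)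
  have h₃ := h₁.t_eq
  have h₄ := h₂.t_eq
  have ht := h.t_eq
  have hze := (h.rot_neg hp).spoke_end hp nf hz
  simp only [List.mem_cons, List.not_mem_nil, or_false, not_or, hp.pp, S.s_r] at *
  refine n₂ ⟨S.r (p k), ⟨?_, ?_⟩, fun h' => ?_⟩
  · rw [S.s_r]; grind
  · rw [S.t_r]; grind
  · have := S.t_r (p k)
    rw [h'] at this
    grind

omit nf in
theorem Hex.spokes_half {x z : D} (h' : S.Hex p e x (p (S.r z)))
    (hxe : S.t x ≠ S.s g ∧ S.t x ≠ S.s (p f))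
    (hze : S.t z ≠ S.s (p e) ∧ S.t z ≠ S.s (p g)) :
    S.Spoke g (p e) (S.r (p (S.r z))) ∧ S.Spoke (p e) (p f) (p x) := by
  have h₃ := h'.t_eq
  have ht := h.t_eq
  have r₁ := S.s_r (p (S.r z))
  have r₂ := S.t_r (p (S.r z))
  have r₃ := S.s_r z
  simp only [hp.pp] at *
  refine ⟨⟨⟨?_, ?_⟩, fun h => ?_⟩, ⟨?_, ?_⟩, fun h => ?_⟩ <;> grind

theorem Hex.bridgedChart (hs : S.s.Surjective) (hS : S.Conn) (n₂ : ¬ ∃ x, S.Spoke f g x)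
    (n₅ : ¬ ∃ x, S.Spoke (p f) (p g) x) {x z : D} (hx : S.Spoke e f x)
    (hz : S.Spoke (p g) e z) : S.Charted bridgedChart := by
  have h' := h.of_spokes hp nf hx hz
  have hn := h.nodup hp
  have ht := h.t_eq
  have ht' := h'.t_eq
  have k₀ := (h.rot_neg hp).spoke_end hp nf hz
  have k₁ := h.spoke_end hp nf hx
  simp only [List.nodup_cons, List.mem_cons, List.not_mem_nil, or_false, not_or,
      not_false_eq_true, List.nodup_nil, and_true, hp.pp, S.s_r] at hn k₀ k₁ ht'
  obtain ⟨hz', hx'⟩ := h.spokes_half hp h' (by tauto) (by tauto)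
  have c₀ := (h.rot_neg hp).adj_iff_of_spoke hp nf hz
  have c₁ := h.adj_iff_of_spoke hp nf hx
  have c₂ := (h.rot hp).adj_iff_of_no_spoke n₂
  have c₃ := (h.rot_rot hp).adj_iff_of_spoke hp nf hz'
  have c₄ := (h.half hp).adj_iff_of_spoke hp nf hx'
  have c₅ := ((h.half hp).rot hp).adj_iff_of_no_spoke n₅
  have c₇ := (h'.rot hp).adj_iff_of_no_spoke (h.no_third_spoke hp nf hx hz n₂)
  have c₆ := ((h'.half hp).rot hp).adj_iff_of_no_spoke (by
    have := (h.half hp).no_third_spoke hp nf hx' (z := S.r (p (S.r z))) (by rwa [hp.pp]) n₅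
    rwa [r_r] at this)
  simp only [hp.pp, S.s_r, S.t_r] at c₃ c₄ c₅ c₆ c₇
  rw [← ht'.2.1] at c₇ c₃
  rw [← ht'.1, ht.1] at c₇
  rw [ht'.2.2.2.2.1] at c₄
  rw [← ht'.2.2.2.1, ht.2.2.2.1] at c₆
  have hne : S.t x ≠ S.t z := fun h' => by
    have h₁ := (c₇ (S.s f)).2 (.inl rfl)
    rw [h', c₆] at h₁
    grind
  refine charted_of_nodup hs hS
    ![S.s e, S.s f, S.s g, S.s (p e), S.s (p f), S.s (p g), S.t z, S.t x] ?_ ?_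
  · change [S.s e, S.s f, S.s g, S.s (p e), S.s (p f), S.s (p g), S.t z, S.t x].Nodup
    simp only [List.nodup_cons, List.mem_cons, List.not_mem_nil, or_false, not_or,
      not_false_eq_true, List.nodup_nil, and_true] at *
    grind
  · intro i w
    fin_cases i
    · refine (c₀ w).trans ?_; simp [DartSystem.bridgedChart]
    · refine (c₁ w).trans ?_; simp [DartSystem.bridgedChart]
    · refine (c₂ w).trans ?_; simp [DartSystem.bridgedChart]
    · refine (c₃ w).trans ?_; simp [DartSystem.bridgedChart]
    · refine (c₄ w).trans ?_; simp [DartSystem.bridgedChart]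
    · refine (c₅ w).trans ?_; simp [DartSystem.bridgedChart]
    · refine (c₆ w).trans ?_; simp [DartSystem.bridgedChart, or_comm]
    · refine (c₇ w).trans ?_; simp [DartSystem.bridgedChart]

theorem Hex.cubeChart (hs : S.s.Surjective) (hS : S.Conn) {x z k : D} (hx : S.Spoke e f x)
    (hz : S.Spoke (p g) e z) (hk : S.Spoke f g k) : S.Charted cubeChart := by
  have h' := h.of_spokes hp nf hx hz
  have h'' := (h.rot hp).of_spokes hp nf hk (by rwa [hp.pp])
  have hn := h.nodup hp
  have ht := h.t_eq
  have ht' := h'.t_eq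
  have ht'' := h''.t_eq
  have k₀ := (h.rot_neg hp).spoke_end hp nf hz
  have k₁ := h.spoke_end hp nf hx
  have k₂ := (h.rot hp).spoke_end hp nf hk
  simp only [List.nodup_cons, List.mem_cons, List.not_mem_nil, or_false, not_or,
      not_false_eq_true, List.nodup_nil, and_true, hp.pp, S.s_r] at hn k₀ k₁ k₂ ht' ht''
  obtain ⟨hz', hx'⟩ := h.spokes_half hp h' (by tauto) (by tauto)
  obtain ⟨hx'', hk'⟩ := (h.rot hp).spokes_half hp h'' (by tauto) (by rw [hp.pp]; tauto)
  -- The hexagons built on `e` and on `f` each give a spoke at `s (p f)`; by uniqueness it is the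
  -- same one, so the ends of `k` and `z` coincide.
  have hkz : S.t k = S.t z := by
    have := (h.half hp).spoke_unique hp nf hx'' hx'
    have h₁ := congrArg S.t this
    rw [S.t_r] at h₁
    grind
  have c₀ := (h.rot_neg hp).adj_iff_of_spoke hp nf hz
  have c₁ := h.adj_iff_of_spoke hp nf hx
  have c₂ := (h.rot hp).adj_iff_of_spoke hp nf hk
  have c₃ := (h.rot_rot hp).adj_iff_of_spoke hp nf hz'
  have c₄ := (h.half hp).adj_iff_of_spoke hp nf hx'
  have c₅ := ((h.half hp).rot hp).adj_iff_of_spoke hp nf hk'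
  have hb : S.Spoke x (p (S.r z)) (S.r (p k)) := by
    have r₁ := S.s_r (p k)
    have r₂ := S.t_r (p k)
    refine ⟨⟨?_, ?_⟩, fun h => ?_⟩ <;> grind
  have ha : S.Spoke (p x) (S.r z) (S.r k) := by
    have r₁ := S.s_r k
    have r₂ := S.t_r k
    have r₃ := S.t_r z
    have hz₁ := hz.1.1
    have hk₁ := hk.1.1
    refine ⟨⟨?_, ?_⟩, fun h => ?_⟩ <;> grind
  have c₇ := (h'.rot hp).adj_iff_of_spoke hp nf hb
  have c₆ := ((h'.half hp).rot hp).adj_iff_of_spoke hp nf (x := S.r k) (by rwa [hp.pp])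
  simp only [hp.pp, S.s_r, S.t_r] at c₃ c₄ c₅ c₆ c₇
  rw [← ht'.2.1] at c₇ c₃
  rw [← ht'.1, ht.1, ← ht''.2.2.2.1, ht.2.2.2.2.1] at c₇
  rw [ht'.2.2.2.2.1] at c₄
  rw [← ht'.2.2.2.1, ht.2.2.2.1, ← hk.1.1, ht.2.1] at c₆
  rw [hkz] at c₂
  rw [ht''.2.2.2.2.1] at c₅
  have hne : S.t x ≠ S.t z := fun h' => by
    have h₁ := (c₇ (S.s f)).2 (.inl rfl)
    rw [h', c₆] at h₁
    grind
  refine charted_of_nodup hs hS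
    ![S.s e, S.s f, S.s g, S.s (p e), S.s (p f), S.s (p g), S.t z, S.t x] ?_ ?_
  · change [S.s e, S.s f, S.s g, S.s (p e), S.s (p f), S.s (p g), S.t z, S.t x].Nodup
    simp only [List.nodup_cons, List.mem_cons, List.not_mem_nil, or_false, not_or,
      not_false_eq_true, List.nodup_nil, and_true] at *
    grind
  · intro i w
    fin_cases i
    · refine (c₀ w).trans ?_; simp [DartSystem.cubeChart]
    · refine (c₁ w).trans ?_; simp [DartSystem.cubeChart]
    · refine (c₂ w).trans ?_; simp [DartSystem.cubeChart]
    · refine (c₃ w).trans ?_; simp [DartSystem.cubeChart]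
    · refine (c₄ w).trans ?_; simp [DartSystem.cubeChart]
    · refine (c₅ w).trans ?_; simp [DartSystem.cubeChart]
    · refine (c₆ w).trans ?_; simp [DartSystem.cubeChart, or_left_comm]
    · refine (c₇ w).trans ?_; simp [DartSystem.cubeChart]

end

end DartSystem
end SimpleGraph

/-! ### Hexagons with alternating spokes -/

namespace SimpleGraph
open DartSystem
namespace DartSystem

variable {D V W : Type*} {S : DartSystem D V} {T : DartSystem D W} {p : D → D} {e f g : D}

section

variable (hp : IsDeck S.A p) (nf : ∀ e, p e ≠ S.r e) (h : S.Hex p e f g)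
include hp nf h

theorem Hex.spoke_half_of_no_spoke (n₃ : ¬ ∃ x, S.Spoke g (p e) x) {z : D}
    (hz : S.Spoke (p g) e z) : S.Spoke (p e) (p f) (p (S.r z)) := by
  have ht := h.t_eq
  have k₀ := (h.rot_neg hp).spoke_end hp nf hz
  simp only [List.mem_cons, List.not_mem_nil, or_false, not_or] at k₀
  have hze : S.To (S.r z) e := by
    obtain ⟨h₁, h₂⟩ := hz
    have := S.ext z e
    simp only [To, S.s_r, S.t_r] at *
    grind
  refine (h.spoke_or_half hp (.inr hze) (fun h' => hze.asymm (h' ▸ h.1)) (fun h' => ?_)).resolve_right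
    fun h => n₃ ⟨_, h⟩
  have := S.s_r z
  rw [h'] at this
  exact k₀.1 this.symm

/-- The ends of alternating spokes have degree two. -/
theorem Hex.alternating (n₃ : ¬ ∃ x, S.Spoke g (p e) x) {z : D} (hz : S.Spoke (p g) e z) :
    S.t z ≠ S.t (p (S.r z)) ∧ S.t (p (S.r (p f))) = S.t z ∧
    (∀ q, S.graph.Adj (S.t z) q ↔ q = S.s e ∨ q = S.s (p (S.r (p f)))) ∧
    S.s (p (S.r (p g))) = S.t (p (S.r z)) ∧ S.t (p (S.r (p g))) = S.s (p (S.r (p f))) := by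
  have hs : ∀ e f, S.A e f → S.A f e := fun _ _ => A.symm
  have hn := h.nodup hp
  have ht := h.t_eq
  have k₀ := (h.rot_neg hp).spoke_end hp nf hz
  have hz' := h.spoke_half_of_no_spoke hp nf n₃ hz
  have k₄ := (h.half hp).spoke_end hp nf hz'
  have c₀ := (h.rot_neg hp).adj_iff_of_spoke hp nf hz
  have c₄ := (h.half hp).adj_iff_of_spoke hp nf hz'
  simp only [List.nodup_cons, List.mem_cons, List.not_mem_nil, or_false, not_or,
      not_false_eq_true, List.nodup_nil, and_true, hp.pp] at hn k₀ k₄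
  have hzs : S.s z = S.s e := hz.1.1.symm.trans ht.2.2.2.2.2
  have hzs' : S.s (p (S.r z)) = S.s (p f) := hz'.1.1.symm.trans ht.2.2.2.1
  have hE : S.t z ≠ S.t (p (S.r z)) := fun h' => by
    refine hp.pn (S.r z) (.inr ⟨?_, ?_⟩)
    · rw [S.s_r, h']
    · rw [S.t_r, hzs, hzs']; grind
  have hze : S.To (S.r z) e := by
    obtain ⟨h₁, h₂⟩ := hz
    have := S.ext z e
    simp only [To, S.s_r, S.t_r] at *
    grind
  have hzg : S.To (S.r z) (S.r (p g)) := To_r.2 hz.1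
  have hw : S.A (S.r z) (p (S.r (p f))) := by
    rw [← hp.A_p_left]
    refine .inr ⟨?_, ?_⟩
    · rw [S.t_r, hzs']
    · rw [S.s_r]; grind
  have hpfg : S.A (S.r (p f)) (S.r (p g)) := .inr (To_r.2 h.2.2.2.2.1)
  have hw' : S.To (p (S.r (p f))) (S.r z) := by
    refine hw.resolve_left fun h' => ?_
    have h₁ : S.s (p (S.r (p f))) = S.s e := by rw [← h'.1, S.t_r, hzs]
    have h₂ := (c₀ _).1 ⟨_, h₁, rfl⟩
    rcases h₂ with h₂ | h₂ | h₂
    · have : p (S.r (p f)) = S.r (p g) := S.ext _ _ (by rw [h₁, S.s_r, ht.2.2.2.2.2])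
        (by rw [h₂, S.t_r])
      rw [← this] at hpfg
      exact hp.pn _ hpfg
    · have h₃ : p (S.r (p f)) = e := S.ext _ _ h₁ (by rw [h₂, ht.1])
      have h₄ : S.r (p f) = p e := by rw [← h₃, hp.pp]
      have := S.s_r (p f)
      rw [h₄] at this
      grind
    · have := h'.2
      rw [S.s_r] at this
      exact this h₂.symm
  -- Every dart entering `r z` is carried by `p` to the same dart `r (p f)`, so there is only one.
  have key : ∀ w, S.To w (S.r z) → p w = S.r (p f) ∧
      S.s (p (S.r (p g))) = S.t (p (S.r z)) ∧ S.t (p (S.r (p g))) = S.s w := by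
    intro w hwz
    have hwz₁ := hwz.1
    rw [S.s_r] at hwz₁
    have hsw : S.s w ≠ S.s (p f) := fun h' => by
      have h₂ := (c₄ (S.t w)).1 ⟨w, h', rfl⟩
      grind
    have c₁ : ¬ S.A e (p w) := by
      rw [← hp.A_p_left]
      simp only [A, To, S.s_r, S.t_r] at *
      grind
    have c₂ : ¬ S.A e (p (S.r (p g))) := by
      rw [← hp.A_p_left]
      simp only [A, To, S.s_r, S.t_r] at *
      grind
    have d₁ : e ≠ w := fun h' => hwz.asymm (h' ▸ hze)
    have d₂ : S.r (p g) ≠ w := fun h' => hwz.asymm (h' ▸ hzg)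
    have d₃ : e ≠ S.r (p g) := fun h' => by
      have := S.t_r (p g)
      rw [← h'] at this
      grind
    have c₃ : S.A (S.r (p g)) (p w) := by
      rcases hp.two (S.r z) e (S.r (p g)) w (.inl hze) (.inl hzg) (.inr hwz) d₃ d₂ d₁
        with h' | h' | h'
      · exact absurd h' c₂
      · exact h'
      · exact absurd h' c₁
    rcases mix_hex_or hp nf hzg hwz c₃ with h' | ⟨a₁, a₂, a₃, a₄⟩ | ⟨a₁, a₂, a₃, a₄⟩
    · have ht' := h'.t_eq
      simp only [hp.pp, S.s_r, S.t_r] at ht'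
      refine ⟨S.ext _ _ ?_ ?_, ?_, ?_⟩
      · rw [← ht'.2.1, S.s_r]; grind
      · rw [ht'.2.2.1, S.t_r]; grind
      · exact ht'.2.2.2.1.symm
      · exact ht'.2.2.2.2.1
    · exact absurd (a₃.symm.trans hzs') hsw
    · rw [S.s_r] at a₂
      have := (c₄ (S.t z)).1 ⟨S.r (p (S.r (p g))), by rw [S.s_r, ← a₃, hzs'],
        by rw [S.t_r, a₂]⟩
      grind
  refine ⟨hE, by rw [hw'.1, S.s_r], fun q => ⟨?_, ?_⟩, (key _ hw').2.1, (key _ hw').2.2⟩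
  · rintro ⟨d, hd, rfl⟩
    by_cases h₁ : S.t d = S.s e
    · exact .inl h₁
    have h₂ : S.To (S.r d) (S.r z) := To_r.2 ⟨hd.symm, fun h' => h₁ (by rw [← h', hzs])⟩
    have h₃ := (key _ h₂).1
    right
    rw [← h₃, hp.pp, S.s_r]
  · rintro (rfl | rfl)
    · exact ⟨S.r z, S.s_r z, by rw [S.t_r, hzs]⟩
    · exact ⟨S.r (p (S.r (p f))), by rw [S.s_r, hw'.1, S.s_r], S.t_r _⟩

theorem Hex.tetraChart (hs : S.s.Surjective) (hS : S.Conn) (n₁ : ¬ ∃ x, S.Spoke e f x)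
    (n₃ : ¬ ∃ x, S.Spoke g (p e) x) (n₅ : ¬ ∃ x, S.Spoke (p f) (p g) x) {x y z : D}
    (hx : S.Spoke (p g) e x) (hy : S.Spoke f g y) (hz : S.Spoke (p e) (p f) z) :
    S.Charted tetraChart := by
  have hn := h.nodup hp
  have ht := h.t_eq
  have h₂ := h.rot_rot hp
  have h₄ := (h.half hp).rot hp
  have hpx : p (S.r x) = z :=
    (h.half hp).spoke_unique hp nf (h.spoke_half_of_no_spoke hp nf n₃ hx) hz
  have hpy : p (S.r y) = x := by
    have := h₂.spoke_half_of_no_spoke hp nf n₅ (z := y) (by rwa [hp.pp])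
    rw [hp.pp] at this
    exact (h.rot_neg hp).spoke_unique hp nf this hx
  obtain ⟨a₁, a₂, a₃, a₄, a₅⟩ := h.alternating hp nf n₃ hx
  obtain ⟨b₁, b₂, b₃, b₄, b₅⟩ := h₂.alternating hp nf n₅ (z := y)
    (by rwa [hp.pp])
  obtain ⟨d₁, d₂, d₃, d₄, d₅⟩ := h₄.alternating hp nf
    (by rwa [hp.pp, hp.pp]) (z := z) (by rwa [hp.pp])
  simp only [hp.pp] at b₂ b₃ b₄ b₅ d₂ d₃ d₄ d₅
  have c₀ := (h.rot_neg hp).adj_iff_of_spoke hp nf hx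
  have c₁ := h.adj_iff_of_no_spoke n₁
  have c₂ := (h.rot hp).adj_iff_of_spoke hp nf hy
  have c₃ := (h.rot_rot hp).adj_iff_of_no_spoke n₃
  have c₄ := (h.half hp).adj_iff_of_spoke hp nf hz
  have c₅ := ((h.half hp).rot hp).adj_iff_of_no_spoke n₅
  have k₀ := (h.rot_neg hp).spoke_end hp nf hx
  have k₂ := (h.rot hp).spoke_end hp nf hy
  have k₄ := (h.half hp).spoke_end hp nf hz
  rw [hpx] at a₁ a₄
  rw [hpy] at b₁ b₄
  simp only [List.nodup_cons, List.mem_cons, List.not_mem_nil, or_false, not_or,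
      not_false_eq_true, List.nodup_nil, and_true, hp.pp] at hn k₀ k₂ k₄ c₅
  -- the common neighbour of the ends
  have hu₂ : S.s (p (S.r e)) = S.s (p (S.r (p f))) := by
    have := (a₃ _).1 ⟨_, b₄, b₅⟩
    refine this.resolve_left fun h' => ?_
    have h₁ := (b₃ _).2 (.inr rfl)
    rw [h'] at h₁
    have := (c₀ _).1 h₁.symm
    grind
  have hu₄ : S.s (p (S.r g)) = S.s (p (S.r (p f))) := by
    have := (d₃ _).1 ⟨_, a₄, a₅⟩
    refine (this.resolve_left fun h' => ?_).symm
    have h₁ := (a₃ _).2 (.inr rfl)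
    rw [h'] at h₁
    have := (c₄ _).1 h₁.symm
    grind
  rw [hu₂] at b₃
  rw [hu₄] at d₃
  have c₉ : ∀ q, S.graph.Adj (S.s (p (S.r (p f)))) q ↔ q = S.t x ∨ q = S.t y ∨ q = S.t z := by
    intro q
    constructor
    · rintro ⟨d, hd, rfl⟩
      by_cases hdx : S.t d = S.t x
      · exact .inl hdx
      have hdw : S.A (p (S.r d)) (S.r (p f)) := by
        rw [hp.A_p_left]
        refine .inl ⟨by rw [S.t_r, hd], ?_⟩
        rw [S.s_r, a₂]
        exact hdx
      have r₁ := S.s_r (p f)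
      have r₂ := S.t_r (p f)
      have hzs := hz.1.1
      have hk : p (S.r d) = S.r (p g) ∨ p (S.r d) = S.r (p e) ∨ p (S.r d) = z := by
        rcases hdw with hdw | hdw
        · have q₁ := hdw.1
          have q₂ := (c₅ (S.s (p (S.r d)))).1 ⟨S.r (p (S.r d)), by rw [S.s_r]; grind, S.t_r _⟩
          have q₃ := hdw.2
          left
          refine S.ext _ _ ?_ ?_
          · rw [S.s_r]; grind
          · rw [S.t_r]; grind
        · have q₁ := hdw.1
          have q₂ := (c₄ (S.t (p (S.r d)))).1 ⟨p (S.r d), by grind, rfl⟩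
          have q₃ := hdw.2
          right
          rcases q₂ with q₂ | q₂ | q₂
          · left
            refine S.ext _ _ ?_ ?_
            · rw [S.s_r]; grind
            · rw [S.t_r]; grind
          · grind
          · right
            refine S.ext _ _ ?_ q₂
            grind
      have hd' : S.t d = S.s (p (p (S.r d))) := by rw [hp.pp, S.s_r]
      rcases hk with hk | hk | hk
      · rw [hd', hk]; exact .inr (.inr a₄)
      · rw [hd', hk, d₄]
        refine .inr (.inl ?_)
        have := h₄.spoke_half_of_no_spoke hp nf (by rwa [hp.pp, hp.pp]) (z := z) (by rwa [hp.pp])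
        rw [hp.pp, hp.pp] at this
        rw [(h.rot hp).spoke_unique hp nf this hy]
      · rw [hd', hk, ← hpx, hp.pp, S.s_r]; exact .inl rfl
    · rintro (rfl | rfl | rfl)
      · exact ((a₃ _).2 (.inr rfl)).symm
      · exact ((b₃ _).2 (.inr rfl)).symm
      · exact ((d₃ _).2 (.inr rfl)).symm
  have hpz : p (S.r z) = y := by
    have := h₄.spoke_half_of_no_spoke hp nf (by rwa [hp.pp, hp.pp]) (z := z) (by rwa [hp.pp])
    rw [hp.pp, hp.pp] at this
    exact (h.rot hp).spoke_unique hp nf this hy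
  rw [hpz] at d₁
  set u := S.s (p (S.r (p f))) with hu
  have ux := (a₃ u).2 (.inr rfl)
  have uy := (b₃ u).2 (.inr rfl)
  have uz := (d₃ u).2 (.inr rfl)
  have u₀ : S.s e ≠ u := fun h' => by
    rw [← h'] at uy
    have := (c₀ _).1 uy.symm
    grind
  have u₁ : S.s f ≠ u := fun h' => by
    rw [← h'] at uy
    have := (c₁ _).1 uy.symm
    grind
  have u₂ : S.s g ≠ u := fun h' => by
    rw [← h'] at ux
    have := (c₂ _).1 ux.symm
    grind
  have u₃ : S.s (p e) ≠ u := fun h' => by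
    rw [← h'] at uy
    have := (c₃ _).1 uy.symm
    grind
  have u₄ : S.s (p f) ≠ u := fun h' => by
    rw [← h'] at ux
    have := (c₄ _).1 ux.symm
    grind
  have u₅ : S.s (p g) ≠ u := fun h' => by
    rw [← h'] at uy
    have := (c₅ _).1 uy.symm
    grind
  have u₆ := ux.ne
  have u₇ := uy.ne
  have u₈ := uz.ne
  refine charted_of_nodup hs hS ![S.s e, S.s f, S.s g, S.s (p e), S.s (p f), S.s (p g),
    S.t x, S.t y, S.t z, u] ?_ ?_
  · change [S.s e, S.s f, S.s g, S.s (p e), S.s (p f), S.s (p g), S.t x, S.t y, S.t z, u].Nodup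
    simp only [List.nodup_cons, List.mem_cons, List.not_mem_nil, or_false, not_or,
      not_false_eq_true, List.nodup_nil, and_true] at *
    grind
  · intro i w
    fin_cases i
    · refine (c₀ w).trans ?_; simp [DartSystem.tetraChart]
    · refine (c₁ w).trans ?_; simp [DartSystem.tetraChart]
    · refine (c₂ w).trans ?_; simp [DartSystem.tetraChart]
    · refine (c₃ w).trans ?_; simp [DartSystem.tetraChart]
    · refine (c₄ w).trans ?_; simp [DartSystem.tetraChart]
    · refine (c₅ w).trans ?_; simp [DartSystem.tetraChart]
    · refine (a₃ w).trans ?_; simp [DartSystem.tetraChart]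
    · refine (b₃ w).trans ?_; simp [DartSystem.tetraChart]
    · refine (d₃ w).trans ?_; simp [DartSystem.tetraChart]
    · refine (c₉ w).trans ?_; simp [DartSystem.tetraChart]

end

end DartSystem
end SimpleGraph

/-! ### Classification of the graphs with a hexagon -/

namespace SimpleGraph
open DartSystem
namespace DartSystem

variable {D V W : Type*} {S : DartSystem D V} {T : DartSystem D W} {p : D → D} {e f g : D}

/-- `p` matches the neighbours of `e` with those of `p e`, and there is at most one spoke at each
vertex; so opposite edges of the hexagon have equally many spokes at their ends. -/
theorem Hex.balance (hp : IsDeck S.A p) (nf : ∀ e, p e ≠ S.r e) (h : S.Hex p e f g) :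
    (((∃ x, S.Spoke (p g) e x) ∨ ∃ x, S.Spoke e f x) →
      ((∃ x, S.Spoke g (p e) x) ∨ ∃ x, S.Spoke (p e) (p f) x)) ∧
    (((∃ x, S.Spoke (p g) e x) ∧ ∃ x, S.Spoke e f x) →
      ((∃ x, S.Spoke g (p e) x) ∧ ∃ x, S.Spoke (p e) (p f) x)) := by
  refine ⟨?_, ?_⟩
  · rintro (⟨z, hz⟩ | ⟨x, hx⟩)
    · by_cases n₃ : ∃ x, S.Spoke g (p e) x
      · exact .inl n₃
      · exact .inr ⟨_, h.spoke_half_of_no_spoke hp nf n₃ hz⟩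
    · rcases h.spoke_or_half hp (.inl hx.1) hx.2 (fun h' => hx.1.asymm (h' ▸ h.2.2.2.2.2))
        with h' | h'
      · exact .inr ⟨_, h'⟩
      · exact .inl ⟨_, h'⟩
  · rintro ⟨⟨z, hz⟩, ⟨x, hx⟩⟩
    have k₀ := (h.rot_neg hp).spoke_end hp nf hz
    have k₁ := h.spoke_end hp nf hx
    simp only [List.mem_cons, List.not_mem_nil, or_false, not_or, hp.pp] at k₀ k₁
    obtain ⟨h₁, h₂⟩ := h.spokes_half hp (h.of_spokes hp nf hx hz) (by tauto) (by tauto)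
    exact ⟨⟨_, h₁⟩, ⟨_, h₂⟩⟩

theorem Hex.charted (hp : IsDeck S.A p) (nf : ∀ e, p e ≠ S.r e) (h : S.Hex p e f g)
    (hs : S.s.Surjective) (hC : Unsplit S.A) : S.Charted DartSystem.pendantChart ∨
      S.Charted DartSystem.bridgedChart ∨ S.Charted DartSystem.cubeChart ∨
      S.Charted DartSystem.tetraChart := by
  have hS := Conn.of_unsplit hC
  have b₀ := h.balance hp nf
  have b₁ := (h.rot hp).balance hp nf
  have b₂ := (h.rot_rot hp).balance hp nf
  have b₃ := (h.half hp).balance hp nf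
  have b₄ := ((h.half hp).rot hp).balance hp nf
  have b₅ := (h.rot_neg hp).balance hp nf
  have hex := h.exists_spoke hp hC
  have h₁ := h.rot hp
  have h₂ := h.rot_rot hp
  simp only [hp.pp] at b₀ b₁ b₂ b₃ b₄ b₅
  -- Here `aᵢ` says that the `i`-th vertex has a spoke. Balance leaves, up to rotation, one
  -- antipodal pair, two pairs, all six, or every second vertex; three consecutive spokes suffice to
  -- recognise all six.
  have hpat : ∀ a₀ a₁ a₂ a₃ a₄ a₅ : Prop, (a₀ ∨ a₁ → a₃ ∨ a₄) ∧ (a₀ ∧ a₁ → a₃ ∧ a₄) →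
      (a₁ ∨ a₂ → a₄ ∨ a₅) ∧ (a₁ ∧ a₂ → a₄ ∧ a₅) → (a₂ ∨ a₃ → a₅ ∨ a₀) ∧ (a₂ ∧ a₃ → a₅ ∧ a₀) →
      (a₃ ∨ a₄ → a₀ ∨ a₁) ∧ (a₃ ∧ a₄ → a₀ ∧ a₁) → (a₄ ∨ a₅ → a₁ ∨ a₂) ∧ (a₄ ∧ a₅ → a₁ ∧ a₂) →
      (a₅ ∨ a₀ → a₂ ∨ a₃) ∧ (a₅ ∧ a₀ → a₂ ∧ a₃) → (a₁ ∨ a₂ ∨ a₃ ∨ a₄ ∨ a₅ ∨ a₀) →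
      (¬ a₀ ∧ ¬ a₂ ∧ ¬ a₃ ∧ ¬ a₅ ∧ a₁) ∨ (¬ a₁ ∧ ¬ a₃ ∧ ¬ a₄ ∧ ¬ a₀ ∧ a₂) ∨
      (¬ a₂ ∧ ¬ a₄ ∧ ¬ a₅ ∧ ¬ a₁ ∧ a₃) ∨ (¬ a₂ ∧ ¬ a₅ ∧ a₁ ∧ a₀) ∨
      (¬ a₃ ∧ ¬ a₀ ∧ a₂ ∧ a₁) ∨ (¬ a₄ ∧ ¬ a₁ ∧ a₃ ∧ a₂) ∨ (a₁ ∧ a₀ ∧ a₂) ∨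
      (¬ a₁ ∧ ¬ a₃ ∧ ¬ a₅ ∧ a₀ ∧ a₂ ∧ a₄) ∨ (¬ a₂ ∧ ¬ a₄ ∧ ¬ a₀ ∧ a₁ ∧ a₃ ∧ a₅) := by
    intro a₀ a₁ a₂ a₃ a₄ a₅
    by_cases a₀ <;> by_cases a₁ <;> by_cases a₂ <;> by_cases a₃ <;> simp_all
  rcases hpat _ _ _ _ _ _ b₀ b₁ b₂ b₃ b₄ b₅ hex with ⟨n₀, n₂, n₃, n₅, x, hx⟩ |
    ⟨n₁, n₃, n₄, n₀, x, hx⟩ | ⟨n₂, n₄, n₅, n₁, x, hx⟩ | ⟨n₂, n₅, ⟨x, hx⟩, z, hz⟩ |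
    ⟨n₃, n₀, ⟨x, hx⟩, z, hz⟩ | ⟨n₄, n₁, ⟨x, hx⟩, z, hz⟩ | ⟨⟨x, hx⟩, ⟨z, hz⟩, k, hk⟩ |
    ⟨n₁, n₃, n₅, ⟨x, hx⟩, ⟨y, hy⟩, z, hz⟩ | ⟨n₂, n₄, n₀, ⟨x, hx⟩, ⟨y, hy⟩, z, hz⟩
  · exact .inl (h.pendantChart hp nf hs hS n₀ n₂ n₃ n₅ hx)
  · exact .inl (h₁.pendantChart hp nf hs hS (by rwa [hp.pp]) n₃ n₄ (by rwa [hp.pp]) hx)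
  · exact .inl (h₂.pendantChart hp nf hs hS (by rwa [hp.pp]) n₄ n₅ (by rwa [hp.pp, hp.pp]) hx)
  · exact .inr (.inl (h.bridgedChart hp nf hs hS n₂ n₅ hx hz))
  · exact .inr (.inl (h₁.bridgedChart hp nf hs hS n₃ (by rwa [hp.pp]) hx (by rwa [hp.pp])))
  · exact .inr (.inl (h₂.bridgedChart hp nf hs hS n₄ (by rwa [hp.pp, hp.pp]) hx (by rwa [hp.pp])))
  · exact .inr (.inr (.inl (h.cubeChart hp nf hs hS hx hz hk)))
  · exact .inr (.inr (.inr (h.tetraChart hp nf hs hS n₁ n₃ n₅ hx hy hz)))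
  · exact .inr (.inr (.inr (h₁.tetraChart hp nf hs hS n₂ n₄ (by rwa [hp.pp])
      (by rwa [hp.pp]) hy hz)))

/-- Existence of a hexagon can be seen from both sides. -/
theorem exists_hex_of_hex (hA : ∀ e f, S.A e f ↔ T.A e f) (nf : ∀ e, T.r e ≠ S.r e)
    (hC : Unsplit S.A) (h : S.Hex T.r e f g) : ∃ e f g, T.Hex S.r e f g := by
  have hp := isDeck_of_A hA
  by_contra hn
  push Not at hn
  -- Around `e`, `f` and a spoke `x` are on the same side but on different `p`-sides; without
  -- hexagons in `T`, `third_of_cross` would give a neighbour that the hexagon in `S` does not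
  -- allow.
  have key : ∀ {e f g}, S.Hex T.r e f g → ¬ ∃ x, S.Spoke e f x := by
    rintro e f g h ⟨x, hx⟩
    have hcr := third_of_cross hA (fun e => (nf e).symm) hn (.inl h.1) (.inl hx.1) hx.2.symm
      (h.not_side hp nf hx) (iff_of_true h.1 hx.1)
    have hnd := h.nodup hp
    have ht := h.t_eq
    have k₁ := h.spoke_end hp nf hx
    simp only [List.nodup_cons, List.mem_cons, List.not_mem_nil, or_false, not_or] at hnd k₁
    rw [← hp.A_p_left, ← hp.A_p_left] at hcr
    obtain ⟨hx₁, hx₂⟩ := hx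
    simp only [A, To, S.s_r, S.t_r] at *
    grind
  have h₄ := key ((h.half hp).rot hp)
  have hex := h.exists_spoke hp hC
  have h₁ := key h
  have h₂ := key (h.rot hp)
  have h₃ := key (h.rot_rot hp)
  have h₅ := key (h.half hp)
  have h₆ := key (h.rot_neg hp)
  tauto

theorem ncard_A [Finite D] (e : D) : {f | S.A e f}.ncard =
    ({f | S.s f = S.s e}.ncard - 1) + ({f | S.s f = S.t e}.ncard - 1) := by
  have h : {f | S.A e f} = S.r '' ({f | S.s f = S.s e} \ {e}) ∪
      ({f | S.s f = S.t e} \ {S.r e}) := by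
    ext f
    have h₁ := S.ext (S.r f) e
    have h₂ := S.ext f (S.r e)
    have h₃ : ∀ x, S.r x = f ↔ x = S.r f := fun x => r_eq_iff
    simp only [Set.mem_ofPred_eq, Set.mem_union, Set.mem_image, Set.mem_sdiff,
      Set.mem_singleton_iff, h₃, exists_eq_right, A, To]
    rw [S.s_r, S.t_r] at *
    have r₁ := S.s_r e
    have r₂ := S.t_r e
    have r₃ := S.s_r f
    have r₄ := S.t_r f
    grind
  have hd : Disjoint (S.r '' ({f | S.s f = S.s e} \ {e})) ({f | S.s f = S.t e} \ {S.r e}) := by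
    rw [Set.disjoint_left]
    rintro _ ⟨x, hx, rfl⟩ ⟨h₁, h₂⟩
    refine h₂ ?_
    have := S.ext x e hx.1 (by rw [← S.s_r]; exact h₁)
    rw [this]; rfl
  rw [h, Set.ncard_union_eq hd, Set.ncard_image_of_injective _ (fun a b h => r_inj.1 h),
    Set.ncard_sdiff_singleton_of_mem (by simp), Set.ncard_sdiff_singleton_of_mem (by simp [S.s_r])]

/-- The numbers of neighbours of darts, read off from a chart. -/
def Profile {n : ℕ} (nb : Fin n → List (Fin n)) (k : ℕ) : Prop :=
  ∃ i, ∃ j ∈ nb i, (nb i).length - 1 + ((nb j).length - 1) = k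

theorem Charted.profile_iff [Finite D] {n : ℕ} {nb : Fin n → List (Fin n)} (h : S.Charted nb)
    (hnb : ∀ i, (nb i).Nodup) (k : ℕ) : Profile nb k ↔ ∃ e, {f | S.A e f}.ncard = k := by
  obtain ⟨v, hi, hs, h⟩ := h
  have hcard : ∀ i, {f | S.s f = v i}.ncard = (nb i).length := fun i => by
    have hinj : Set.InjOn S.t {f | S.s f = v i} := fun a ha b hb hab =>
      S.ext a b (Eq.trans ha (Eq.symm hb)) hab
    have him : S.t '' {f | S.s f = v i} = v '' ((nb i).toFinset : Set (Fin n)) := by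
      ext w
      simp only [Set.mem_image, Set.mem_ofPred_eq, List.coe_toFinset]
      refine (h i w).trans ⟨?_, ?_⟩ <;> rintro ⟨j, h₁, h₂⟩ <;> exact ⟨j, h₁, h₂.symm⟩
    rw [← hinj.ncard_image, him, Set.ncard_image_of_injective _ hi,
      Set.ncard_coe_finset, List.toFinset_card_of_nodup (hnb i)]
  constructor
  · rintro ⟨i, j, hj, rfl⟩
    obtain ⟨e, h₁, h₂⟩ := (h i (v j)).2 ⟨j, hj, rfl⟩
    exact ⟨e, by rw [ncard_A, h₁, h₂, hcard, hcard]⟩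
  · rintro ⟨e, rfl⟩
    obtain ⟨i, hi⟩ := hs (S.s e)
    obtain ⟨j, hj, hj'⟩ := (h i (S.t e)).1 ⟨e, hi.symm, rfl⟩
    exact ⟨i, j, hj, by rw [ncard_A, ← hi, hj', hcard, hcard]⟩

/-- Both systems have a chart from the list. The numbers of neighbours of darts are `{2, 3}` for the
pendant chart, `{3, 4}` for the bridged one, `{4}` for the cube and `{3}` for the subdivided
tetrahedron, so `A` determines the chart. -/
theorem graph_iso_of_hex [Finite D] (hs : S.s.Surjective) (ht : T.s.Surjective)
    (hA : ∀ e f, S.A e f ↔ T.A e f) (hC : Unsplit S.A) (nf : ∀ e, T.r e ≠ S.r e)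
    (h : S.Hex T.r e f g) : Nonempty (S.graph ≃g T.graph) := by
  have hA' : ∀ e f, T.A e f ↔ S.A e f := fun e f => (hA e f).symm
  have hAA : T.A = S.A := by funext e f; exact propext (hA' e f)
  obtain ⟨e', f', g', h'⟩ := exists_hex_of_hex hA nf hC h
  have hn : ∀ {n m : ℕ} {nb : Fin n → List (Fin n)} {nb' : Fin m → List (Fin m)},
      S.Charted nb → T.Charted nb' → (∀ i, (nb i).Nodup) → (∀ i, (nb' i).Nodup) →
      ∀ k, Profile nb k ↔ Profile nb' k := by
    intro n m nb nb' h₁ h₂ h₃ h₄ k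
    rw [h₁.profile_iff h₃, h₂.profile_iff h₄, hAA]
  have d₁ : ∀ i, (pendantChart i).Nodup := by decide
  have d₂ : ∀ i, (bridgedChart i).Nodup := by decide
  have d₃ : ∀ i, (cubeChart i).Nodup := by decide
  have d₄ : ∀ i, (tetraChart i).Nodup := by decide
  have p₁ : Profile pendantChart 2 ∧ ¬ Profile pendantChart 4 := by unfold Profile; decide
  have p₂ : ¬ Profile bridgedChart 2 ∧ Profile bridgedChart 4 ∧ Profile bridgedChart 3 := by
    unfold Profile; decide
  have p₃ : ¬ Profile cubeChart 2 ∧ Profile cubeChart 4 ∧ ¬ Profile cubeChart 3 := by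
    unfold Profile; decide
  have p₄ : ¬ Profile tetraChart 2 ∧ ¬ Profile tetraChart 4 := by unfold Profile; decide
  rcases h.charted (isDeck_of_A hA) nf hs hC with h₁ | h₁ | h₁ | h₁ <;>
    rcases h'.charted (isDeck_of_A hA') (fun e => (nf e).symm) ht (hAA ▸ hC)
      with h₂ | h₂ | h₂ | h₂ <;>
    first
    | exact h₁.iso h₂
    | have := hn h₁ h₂ (by assumption) (by assumption)
      have q₂ := this 2
      have q₃ := this 3
      have q₄ := this 4
      clear * - q₂ q₃ q₄ p₁ p₂ p₃ p₄
      tauto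

theorem graph_iso_of_A [Finite D] [Nonempty D] (hs : S.s.Surjective) (ht : T.s.Surjective)
    (hS : S.Conn) (hT : T.Conn) (hA : ∀ e f, S.A e f ↔ T.A e f) :
    Nonempty (S.graph ≃g T.graph) := by
  by_cases hC : Unsplit S.A
  swap
  · exact graph_iso_of_split hs ht hS hT hA hC
  by_cases nf : ∀ e, T.r e ≠ S.r e
  swap
  · push Not at nf
    obtain ⟨e, he⟩ := nf
    exact graph_iso_of_common_reversal hs ht hA hC he
  have hA' : ∀ e f, T.A e f ↔ S.A e f := fun e f => (hA e f).symm
  have hAA : T.A = S.A := by funext e f; exact propext (hA' e f)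
  by_cases nb : ∀ e f g, ¬ S.Hex T.r e f g
  swap
  · push Not at nb
    obtain ⟨e, f, g, h⟩ := nb
    exact graph_iso_of_hex hs ht hA hC nf h
  by_cases nb' : ∀ e f g, ¬ T.Hex S.r e f g
  swap
  · push Not at nb'
    obtain ⟨e, f, g, h⟩ := nb'
    exact (graph_iso_of_hex ht hs hA' (hAA ▸ hC) (fun e => (nf e).symm) h).map (·.symm)
  exact graph_iso_of_no_hex hs ht hA hC nf nb nb' (Classical.arbitrary D)

/-! ### Return to graphs -/

/-- The dart system of a graph. -/
def ofGraph (X : SimpleGraph V) : DartSystem X.Dart V where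
  s e := e.fst
  t e := e.snd
  r e := e.symm
  s_r _ := rfl
  t_r _ := rfl
  s_ne_t e := e.adj.ne
  ext _ _ h h' := Dart.ext _ _ (Prod.ext h h')

theorem ofGraph_graph (X : SimpleGraph V) : (ofGraph X).graph = X := by
  ext a b
  exact ⟨fun ⟨e, h, h'⟩ => h ▸ h' ▸ e.adj, fun h => ⟨⟨(a, b), h⟩, rfl, rfl⟩⟩

theorem ofGraph_A [DecidableEq V] (X : SimpleGraph V) (e f : X.Dart) :
    (ofGraph X).A e f ↔ X.symmEdgeGraph.Adj e f := (X.symmEdgeGraph_adj e f).symm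

theorem ofGraph_s_surjective (X : SimpleGraph V) (hX : X.Connected) [hD : Nonempty X.Dart] :
    (ofGraph X).s.Surjective := fun v => by
  obtain ⟨d⟩ := hD
  obtain ⟨w⟩ := hX.preconnected v d.fst
  cases w with
  | nil => exact ⟨d, rfl⟩
  | cons h _ => exact ⟨⟨(v, _), h⟩, rfl⟩

theorem ofGraph_conn (X : SimpleGraph V) (hX : X.Connected) : (ofGraph X).Conn := by
  intro P hP e f he
  have h₁ : ∀ x, P x → ∀ y, (ofGraph X).s x = (ofGraph X).s y → P y := fun x hx y h => by
    rcases (ofGraph X).s_eq_iff.1 h with rfl | h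
    · exact hx
    · exact hP _ _ (.inl (.inl h)) (hP _ _ (.inr rfl) hx)
  have h₂ : ∀ a b, X.Walk a b → (∀ x, (ofGraph X).s x = a → P x) →
      ∀ x, (ofGraph X).s x = b → P x := by
    intro a b w
    induction w with
    | nil => exact id
    | cons h _ ih =>
      intro ha
      refine ih fun x hx => ?_
      have := hP _ _ (.inr rfl) (ha ⟨(_, _), h⟩ rfl)
      exact h₁ _ this x hx.symm
  obtain ⟨w⟩ := hX.preconnected ((ofGraph X).s e) ((ofGraph X).s f)
  exact h₂ _ _ w (fun x hx => h₁ e he x hx.symm) f rfl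

end DartSystem

theorem symmEdgeGraph_iso_of_iso {V W : Type*} [DecidableEq V] [DecidableEq W]
    {X : SimpleGraph V} {Y : SimpleGraph W} (φ : X ≃g Y) :
    Nonempty (X.symmEdgeGraph ≃g Y.symmEdgeGraph) := by
  refine ⟨⟨⟨fun e => ⟨(φ e.fst, φ e.snd), φ.map_adj_iff.2 e.adj⟩,
    fun e => ⟨(φ.symm e.fst, φ.symm e.snd), φ.symm.map_adj_iff.2 e.adj⟩, fun e => ?_,
    fun e => ?_⟩, ?_⟩⟩
  · exact Dart.ext _ _ (Prod.ext (φ.symm_apply_apply _) (φ.symm_apply_apply _))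
  · exact Dart.ext _ _ (Prod.ext (φ.apply_symm_apply _) (φ.apply_symm_apply _))
  · intro e f
    rw [symmEdgeGraph_adj, symmEdgeGraph_adj]
    simp only [Equiv.coe_fn_mk, φ.injective.eq_iff, ne_eq]

theorem Connected.subsingleton_of_no_adj {V : Type*} {X : SimpleGraph V} (hX : X.Connected)
    (h : ∀ a b, ¬ X.Adj a b) : Subsingleton V := ⟨fun a b => by
  obtain ⟨w⟩ := hX.preconnected a b
  cases w with
  | nil => rfl
  | cons hab _ => exact absurd hab (h _ _)⟩

theorem iso_of_symmEdgeGraph_iso {V W : Type*} [Finite V] [DecidableEq V] [DecidableEq W]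
    {X : SimpleGraph V} {Y : SimpleGraph W} (hX : X.Connected) (hY : Y.Connected)
    (φ : X.symmEdgeGraph ≃g Y.symmEdgeGraph) : Nonempty (X ≃g Y) := by
  by_cases hD : Nonempty X.Dart
  · have hD' : Nonempty Y.Dart := hD.map φ
    have : Finite X.Dart := Finite.of_injective _ Dart.toProd_injective
    have := graph_iso_of_A (S := ofGraph X) (T := (ofGraph Y).comap φ.toEquiv)
      (ofGraph_s_surjective X hX) ((ofGraph_s_surjective Y hY).comp φ.surjective)
      (ofGraph_conn X hX) ?_ fun e f => ?_
    · rwa [comap_graph, ofGraph_graph, ofGraph_graph] at this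
    · intro P hP e f he
      have h := ofGraph_conn Y hY (fun y => P (φ.symm y)) ?_ (φ e) (φ f)
      · simp only [RelIso.symm_apply_apply] at h
        exact h he
      · rintro a b (hab | rfl) h
        · refine hP _ _ (.inl ?_) h
          rw [comap_A]
          simpa using hab
        · refine hP _ _ (.inr ?_) h
          simp [comap]
          rfl
    · rw [comap_A, ofGraph_A, ofGraph_A]
      exact φ.map_adj_iff.symm
  -- Without darts both connected graphs are single vertices.
  · have hD' : ¬ Nonempty Y.Dart := fun h => hD (h.map φ.symm)
    have nX : ∀ a b, ¬ X.Adj a b := fun a b h => hD ⟨⟨(a, b), h⟩⟩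
    have nY : ∀ a b, ¬ Y.Adj a b := fun a b h => hD' ⟨⟨(a, b), h⟩⟩
    obtain ⟨a⟩ := hX.nonempty
    obtain ⟨b⟩ := hY.nonempty
    have sX := hX.subsingleton_of_no_adj nX
    have sY := hY.subsingleton_of_no_adj nY
    exact ⟨⟨⟨fun _ => b, fun _ => a, fun _ => Subsingleton.elim _ _,
      fun _ => Subsingleton.elim _ _⟩, fun {_ _} => iff_of_false (nY _ _) (nX _ _)⟩⟩

end SimpleGraph

theorem mainTheorem2 {V : Type*} {W : Type*} [Fintype V] [DecidableEq V]
    [Fintype W] [DecidableEq W] (X : SimpleGraph V) (Y : SimpleGraph W)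
    (hX : X.Connected) (hY : Y.Connected) :
    Nonempty (X.symmEdgeGraph ≃g Y.symmEdgeGraph) ↔ Nonempty (X ≃g Y) :=
  ⟨fun ⟨φ⟩ => SimpleGraph.iso_of_symmEdgeGraph_iso hX hY φ,
    fun ⟨φ⟩ => SimpleGraph.symmEdgeGraph_iso_of_iso φ⟩
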